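/- **Theorem.** An election consists of a finite set $C$ of candidates and a finite collection $V$ of voters, each of whom has a preference order (a strict linear order) over $C$. A preference order $>$ is *single-peaked* with respect to a linear order $L$ on $C$ (the societal axis) if for all $a,b,c\in C$ with $a\,L\,b\,L\,c$ or $c\,L\,b\,L\,a$, $a>b$ implies $b>c$. The $k$-Approval score of a candidate is the number of voters who rank that candidate among their top $k$ candidates; the candidates with the highest score are the winners, and $p$ is the *unique winner* if $p$ is the only winner. An instance of the single-peaked control-by-adding-voters problem consists of a candidate set $C$, a societal axis $L$ over $C$, a collection $V$ of registered voters and a collection $W$ of unregistered voters (all with preference orders over $C$ that are single-peaked with respect to $L$), a designated candidate $p\in C$, and an integer $\ell\ge 0$. $k$-Approval-#CCAV asks for the number of sets $W'\subseteq W$ with $\|W'\|\le \ell$ such that $p$ is the unique $k$-Approval winner of $(C,V\cup W')$; $k$-Approval-#DCAV asks for the number of sets $W'\subseteq W$ with $\|W'\|\le\ell$ such that $p$ is not the unique $k$-Approval winner of $(C,V\cup W')$. An instance of the single-peaked control-by-deleting-voters problem consists of $C$, $L$, $V$ (single-peaked with respect to $L$), $p$ and $\ell$ in the same way, without $W$.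 $k$-Approval-#CCDV asks for the number of sets $V'\subseteq V$ with $\|V'\|\le\ell$ such that $p$ is the unique $k$-Approval winner of $(C,V\setminus V')$; $k$-Approval-#DCDV asks for the number of sets $V'\subseteq V$ with $\|V'\|\le\ell$ such that $p$ is not the unique $k$-Approval winner of $(C,V\setminus V')$. For each fixed positive integer $k$, the four functions $k$-Approval-#CCAV, $k$-Approval-#CCDV, $k$-Approval-#DCAV and $k$-Approval-#DCDV on single-peaked instances are in $\mathrm{FP}$: each is computable, numbers being written in binary, by a deterministic Turing machine in time polynomial in the length of the instance. -/

import Mathlib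

namespace SPControl

/-! ## Elections, single-peakedness, voting rules -/

/-- A preference order over the `m` candidates `0, …, m - 1`, listed from the best to the worst:
`v r` is the candidate that is ranked at position `r` (position `0` is the top).
A societal axis is a linear order as well and is given in the same way, from left to right. -/
abbrev Ranking (m : ℕ) : Type := Equiv.Perm (Fin m)

/-- In the linear order `v`, candidate `a` comes strictly before candidate `b`.
For a vote this means that `a` is preferred to `b`, for an axis that `a` is to the left of `b`. -/
def Ranking.Before {m : ℕ} (v : Ranking m) (a b : Fin m) : Prop :=
  v.symm a < v.symm b

/-- The preference order `v` is single-peaked with respect to the societal axis `L`. -/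
def SinglePeaked {m : ℕ} (L v : Ranking m) : Prop :=
  ∀ a b c : Fin m,
    (L.Before a b ∧ L.Before b c) ∨ (L.Before c b ∧ L.Before b a) →
      (v.Before a b → v.Before b c)

/-- A voting rule: given the votes `vote i` of some voters `i : ι` and the finite set `S` of the
voters that take part in the election, it returns the set of winners. -/
def VotingRule : Type 1 :=
  ∀ (m : ℕ) (ι : Type), (ι → Ranking m) → Finset ι → Set (Fin m)

/-- The `k`-Approval score of `c`: the number of participating voters that rank `c` among
their top `k` candidates. -/
def score (k : ℕ) {m : ℕ} {ι : Type} (vote : ι → Ranking m) (S : Finset ι) (c : Fin m) : ℕ :=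
  (S.filter fun i => ((vote i).symm c : ℕ) < k).card

/-- The `k`-Approval rule: the candidates with the highest `k`-Approval score win. -/
def kApproval (k : ℕ) : VotingRule := fun _ _ vote S =>
  {c | ∀ d, score k vote S d ≤ score k vote S c}

/-- `p` is the unique winner of the election. -/
def VotingRule.IsUniqueWinner (R : VotingRule) {m : ℕ} {ι : Type} (vote : ι → Ranking m)
    (S : Finset ι) (p : Fin m) : Prop :=
  R m ι vote S = {p}

/-! ## Counting variants of control by adding and by deleting voters -/

/-- A single-peaked instance of control by adding voters: `m` candidates, a societal axis,
registered voters `V`, unregistered voters `W`, the designated candidate `p`, and the bound on the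
number of voters that may be added. All votes are single-peaked with respect to the axis. -/
structure AVInstance where
  m : ℕ
  axis : Ranking m
  nV : ℕ
  V : Fin nV → Ranking m
  nW : ℕ
  W : Fin nW → Ranking m
  p : Fin m
  bound : ℕ
  singlePeaked_V : ∀ i, SinglePeaked axis (V i)
  singlePeaked_W : ∀ i, SinglePeaked axis (W i)

/-- A single-peaked instance of control by deleting voters: `m` candidates, a societal axis,
voters `V`, the designated candidate `p`, and the bound on the number of voters that may be
deleted. All votes are single-peaked with respect to the axis. -/
structure DVInstance where
  m : ℕ
  axis : Ranking m
  nV : ℕ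
  V : Fin nV → Ranking m
  p : Fin m
  bound : ℕ
  singlePeaked_V : ∀ i, SinglePeaked axis (V i)

/-- `p` is the unique winner of the `R`-election with voters `V ∪ W'`. -/
def AVInstance.Wins (I : AVInstance) (R : VotingRule) (W' : Finset (Fin I.nW)) : Prop :=
  R.IsUniqueWinner (Sum.elim I.V I.W) ((Finset.univ : Finset (Fin I.nV)).disjSum W') I.p

/-- `p` is the unique winner of the `R`-election with voters `V - V'`. -/
def DVInstance.Wins (I : DVInstance) (R : VotingRule) (V' : Finset (Fin I.nV)) : Prop :=
  R.IsUniqueWinner I.V (Finset.univ \ V') I.p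

/-- `R`-#CCAV -/
noncomputable def numCCAV (R : VotingRule) (I : AVInstance) : ℕ :=
  {W' : Finset (Fin I.nW) | W'.card ≤ I.bound ∧ I.Wins R W'}.ncard

/-- `R`-#DCAV -/
noncomputable def numDCAV (R : VotingRule) (I : AVInstance) : ℕ :=
  {W' : Finset (Fin I.nW) | W'.card ≤ I.bound ∧ ¬ I.Wins R W'}.ncard

/-- `R`-#CCDV -/
noncomputable def numCCDV (R : VotingRule) (I : DVInstance) : ℕ :=
  {V' : Finset (Fin I.nV) | V'.card ≤ I.bound ∧ I.Wins R V'}.ncard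

/-- `R`-#DCDV -/
noncomputable def numDCDV (R : VotingRule) (I : DVInstance) : ℕ :=
  {V' : Finset (Fin I.nV) | V'.card ≤ I.bound ∧ ¬ I.Wins R V'}.ncard

/-! ## Encoding of instances as strings, and the class FP -/

open Computability (Γ' encodeNat)

/-- A number is written in binary and closed by a comma. -/
def encNat (n : ℕ) : List Γ' := (encodeNat n).map Γ'.bit ++ [Γ'.comma]

/-- A list is written as its entries one after the other, between a pair of brackets. -/
def encList {α : Type} (enc : α → List Γ') (l : List α) : List Γ' :=
  Γ'.bra :: (l.flatMap enc ++ [Γ'.ket])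

/-- A linear order is written as the list of its candidates, first to last. -/
def encRanking {m : ℕ} (v : Ranking m) : List Γ' :=
  encList encNat (List.ofFn fun r => (v r : ℕ))

/-- A collection of votes is written as the list of its votes. -/
def encVotes {m n : ℕ} (V : Fin n → Ranking m) : List Γ' :=
  encList encRanking (List.ofFn V)

def AVInstance.encode (I : AVInstance) : List Γ' :=
  encRanking I.axis ++ (encVotes I.V ++ (encVotes I.W ++ (encNat I.p ++ encNat I.bound)))

def DVInstance.encode (I : DVInstance) : List Γ' :=
  encRanking I.axis ++ (encVotes I.V ++ (encNat I.p ++ encNat I.bound))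

/-- The function `f` on instances, which are written as strings by `enc`, is in FP: a
(deterministic, multi-stack) Turing machine computes from the string `enc I` the binary
representation of `f I`, for every instance `I`, in a number of steps that is bounded by a
polynomial in the length of `enc I`. -/
def InFP {α Γ : Type} (enc : α → List Γ) (f : α → ℕ) : Prop :=
  Nonempty (Turing.TM2ComputableInPolyTime enc encodeNat f)

/-! ### Distinct instances have distinct encodings -/

/-- Encodings can be read off the front of a string without ambiguity. -/
def PrefixFree {α : Type} (enc : α → List Γ') : Prop :=
  ∀ a b x y, enc a ++ x = enc b ++ y → a = b ∧ x = y

theorem prefixFree_encNat : PrefixFree encNat := by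
  have key : ∀ (s t : List Bool) (x y : List Γ'),
      s.map Γ'.bit ++ Γ'.comma :: x = t.map Γ'.bit ++ Γ'.comma :: y → s = t ∧ x = y := by
    intro s
    induction s with
    | nil => intro t x y h; cases t <;> simp_all
    | cons a s ih =>
      intro t x y h
      cases t with
      | nil => simp at h
      | cons b t =>
        simp only [List.map_cons, List.cons_append, List.cons.injEq, Γ'.bit.injEq] at h
        obtain ⟨h1, h2⟩ := ih t x y h.2
        exact ⟨by rw [h.1, h1], h2⟩
  intro a b x y h
  obtain ⟨h1, h2⟩ := key (encodeNat a) (encodeNat b) x y (by simpa [encNat] using h)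
  exact ⟨by simpa using congrArg Computability.decodeNat h1, h2⟩

theorem prefixFree_encList {α : Type} {enc : α → List Γ'} (h : PrefixFree enc)
    (hk : ∀ a x y, enc a ++ x ≠ Γ'.ket :: y) : PrefixFree (encList enc) := by
  intro s
  induction s with
  | nil =>
    intro t x y e
    cases t with
    | nil => simpa [encList] using e
    | cons b t => simp [encList] at e; exact absurd e.symm (hk _ _ _)
  | cons a s ih =>
    intro t x y e
    cases t with
    | nil => simp [encList] at e; exact absurd e (hk _ _ _)
    | cons b t =>
      simp only [encList, List.flatMap_cons, List.cons_append, List.append_assoc,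
        List.cons.injEq, true_and] at e
      obtain ⟨h1, h2⟩ := h _ _ _ _ e
      obtain ⟨h3, h4⟩ := ih t x y (by simpa [encList] using h2)
      exact ⟨by rw [h1, h3], h4⟩

theorem prefixFree_listNat : PrefixFree (encList encNat) :=
  prefixFree_encList prefixFree_encNat fun a x y e => by
    unfold encNat at e
    cases h : encodeNat a <;> simp [h] at e

theorem prefixFree_encRanking {m : ℕ} : PrefixFree (encRanking (m := m)) := by
  intro v w x y e
  obtain ⟨h1, h2⟩ := prefixFree_listNat _ _ _ _ e
  refine ⟨Equiv.ext fun r => Fin.ext ?_, h2⟩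
  exact congrFun (List.ofFn_injective h1) r

theorem prefixFree_listRanking {m : ℕ} : PrefixFree (encList (encRanking (m := m))) :=
  prefixFree_encList prefixFree_encRanking fun a x y e => by
    simp [encRanking, encList] at e

theorem sigma_eq_of_ofFn {m n n' : ℕ} {V : Fin n → Ranking m} {V' : Fin n' → Ranking m}
    (h : List.ofFn V = List.ofFn V') :
    (⟨n, V⟩ : Σ n, Fin n → Ranking m) = ⟨n', V'⟩ := by
  have hn : n = n' := by simpa using congrArg List.length h
  subst hn
  rw [List.ofFn_injective h]

theorem AVInstance.encode_injective : Function.Injective AVInstance.encode := by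
  rintro ⟨m, L, nV, V, nW, W, p, l, h1, h2⟩ ⟨m', L', nV', V', nW', W', p', l', h1', h2'⟩ e
  simp only [AVInstance.encode] at e
  have hL := (prefixFree_listNat _ _ _ _ e).1
  have hm : m = m' := by simpa using congrArg List.length hL
  subst hm
  obtain ⟨rfl, e1⟩ := prefixFree_encRanking _ _ _ _ e
  obtain ⟨hV, e2⟩ := prefixFree_listRanking _ _ _ _ e1
  obtain ⟨hW, e3⟩ := prefixFree_listRanking _ _ _ _ e2
  obtain ⟨hp, e4⟩ := prefixFree_encNat _ _ _ _ e3
  obtain ⟨hl, -⟩ := prefixFree_encNat _ _ [] [] (by simpa using e4)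
  cases sigma_eq_of_ofFn hV
  cases sigma_eq_of_ofFn hW
  cases Fin.ext hp
  cases hl
  rfl

theorem DVInstance.encode_injective : Function.Injective DVInstance.encode := by
  rintro ⟨m, L, nV, V, p, l, h1⟩ ⟨m', L', nV', V', p', l', h1'⟩ e
  simp only [DVInstance.encode] at e
  have hL := (prefixFree_listNat _ _ _ _ e).1
  have hm : m = m' := by simpa using congrArg List.length hL
  subst hm
  obtain ⟨rfl, e1⟩ := prefixFree_encRanking _ _ _ _ e
  obtain ⟨hV, e2⟩ := prefixFree_listRanking _ _ _ _ e1
  obtain ⟨hp, e4⟩ := prefixFree_encNat _ _ _ _ e2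
  obtain ⟨hl, -⟩ := prefixFree_encNat _ _ [] [] (by simpa using e4)
  cases sigma_eq_of_ofFn hV
  cases Fin.ext hp
  cases hl
  rfl

end SPControl

namespace SPControl

open Computability (Γ' encodeNat)
open Turing Function

/-! A single-peaked vote approves an interval of `k` consecutive positions of the axis, or every
candidate if there are at most `k` (`exists_start`). For scoring, a voter is therefore just the
leftmost approved position. Sweep the axis from left to right and decide about each voter at that
position. When the sweep is at position `j`, every candidate from `j + k` on still has score 0, and
the score at `j` is final once the voters starting there are decided. It is thus enough to remember
`k` scores, the number of decisions charged to the bound, a guess `s` of the final score of the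
designated candidate, and whether some other candidate already left has at least `s` points.

Leaving the designated candidate discards wrong guesses, so summing over `s` counts each choice
exactly once, and the final flag says whether the designated candidate fails to be the unique
winner. With all numbers at most `N` there are `2 * (N + 1) ^ (k + 2)` states, polynomially many for
fixed `k`; only the numbers of ways to reach them are large, and these are kept in binary.
`cnt_sweep` identifies the result of the sweep with a sum over all decisions,
`tval_foldl_updateTable` shows that the tables compute it, and `choiceSum_free` turns decisions into
sets of voters. Adding and deleting differ only in the decisions offered to a voter, constructive
and destructive control only in the flag required at the end.

For the machine model, structured stack programs are simulated step for step by multi-stack Turing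
machines (`stepN_code`). Data are binary trees in prefix code, and `PT` is closed under composition,
pairing, case distinction and iteration with polynomially bounded intermediate results. On top of
this, `Poly` treats typed functions, with `Poly.foldl` as the only source of loops. What remains for
the dynamic program is to bound the sizes of its folds (`Poly.run`). -/

/-! ## Structured programs over stacks and their translation to Turing machines -/

/-- The stacks: two for the input string, one for the data, three for scratch work. -/
inductive Stk
  | inp | rev | main | a | b | c
  deriving DecidableEq

instance : Fintype Stk :=
  ⟨{.inp, .rev, .main, .a, .b, .c}, fun k => by cases k <;> simp⟩

/-- The alphabet of a stack. -/
abbrev Alph : Stk → Type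
  | .inp => Γ'
  | .rev => Γ'
  | _ => Bool

/-- The contents of all stacks. -/
abbrev Store : Type := ∀ k, List (Alph k)

/-- Structured stack programs. Tests look at the top of one stack. -/
inductive Cmd : Type
  | push (k : Stk) (x : Alph k)
  | pop (k : Stk)
  | seq (c d : Cmd)
  | ite (k : Stk) (p : Option (Alph k) → Bool) (c d : Cmd)
  | loop (k : Stk) (p : Option (Alph k) → Bool) (c : Cmd)

infixr:60 " ;; " => Cmd.seq

/-- `Exec c S S' t`: started on `S`, the program `c` ends on `S'` after `t` steps. -/
inductive Exec : Cmd → Store → Store → ℕ → Prop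
  | push {k x S} : Exec (.push k x) S (update S k (x :: S k)) 1
  | pop {k S} : Exec (.pop k) S (update S k (S k).tail) 1
  | seq {c d S S' S'' t u} : Exec c S S' t → Exec d S' S'' u → Exec (c ;; d) S S'' (t + u)
  | ite_true {k p c d S S' t} : p (S k).head? = true → Exec c S S' t →
      Exec (.ite k p c d) S S' (1 + t)
  | ite_false {k p c d S S' t} : p (S k).head? = false → Exec d S S' t →
      Exec (.ite k p c d) S S' (1 + t)
  | loop_done {k p c S} : p (S k).head? = false → Exec (.loop k p c) S S 1
  | loop_step {k p c S S' S'' t u} : p (S k).head? = true → Exec c S S' t →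
      Exec (.loop k p c) S' S'' u → Exec (.loop k p c) S S'' (1 + t + u)

namespace Cmd

/-- The labels of the machine of a program. -/
def Lab : Cmd → Type
  | push _ _ => Unit
  | pop _ => Unit
  | seq c d => Lab c ⊕ Lab d
  | ite _ _ c d => Option (Lab c ⊕ Lab d)
  | loop _ _ c => Option (Lab c)

theorem finite_lab : ∀ c : Cmd, Finite (Lab c)
  | push _ _ => inferInstanceAs (Finite Unit)
  | pop _ => inferInstanceAs (Finite Unit)
  | seq c d => by
      have := finite_lab c; have := finite_lab d
      exact inferInstanceAs (Finite (Lab c ⊕ Lab d))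
  | ite _ _ c d => by
      have := finite_lab c; have := finite_lab d
      exact inferInstanceAs (Finite (Option (Lab c ⊕ Lab d)))
  | loop _ _ c => by
      have := finite_lab c
      exact inferInstanceAs (Finite (Option (Lab c)))

/-- The label where a program starts. -/
def entry : ∀ c : Cmd, Lab c
  | push _ _ => ()
  | pop _ => ()
  | seq c _ => Sum.inl (entry c)
  | ite _ _ _ _ => none
  | loop _ _ _ => none

/-- Jump to a label, or halt. -/
def gotoOpt {L : Type} : Option L → TM2.Stmt Alph L Bool
  | none => .halt
  | some l => .goto fun _ => l

/-- Branch on the top of a stack, with a clean internal state afterwards. -/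
def test {L : Type} (k : Stk) (p : Option (Alph k) → Bool) (l l' : Option L) :
    TM2.Stmt Alph L Bool :=
  .peek k (fun _ o => p o) (.branch id (.load (fun _ => false) (gotoOpt l))
    (.load (fun _ => false) (gotoOpt l')))

/-- The statements of the machine of a program whose labels are embedded in `L`, and which
continues at `next`. -/
def code : ∀ (c : Cmd) {L : Type}, (Lab c → L) → Option L → Lab c → TM2.Stmt Alph L Bool
  | push k x, _, _, next, _ => .push k (fun _ => x) (gotoOpt next)
  | pop k, _, _, next, _ => .pop k (fun v _ => v) (gotoOpt next)
  | seq c d, _, emb, next, l =>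
      match l with
      | Sum.inl l => code c (fun x => emb (Sum.inl x)) (some (emb (Sum.inr (entry d)))) l
      | Sum.inr l => code d (fun x => emb (Sum.inr x)) next l
  | ite k p c d, _, emb, next, l =>
      match l with
      | none => test k p (some (emb (some (Sum.inl (entry c)))))
          (some (emb (some (Sum.inr (entry d)))))
      | some (Sum.inl l) => code c (fun x => emb (some (Sum.inl x))) next l
      | some (Sum.inr l) => code d (fun x => emb (some (Sum.inr x))) next l
  | loop k p c, _, emb, next, l =>
      match l with
      | none => test k p (some (emb (some (entry c)))) next
      | some l => code c (fun x => emb (some x)) (some (emb none)) l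

theorem stepAux_gotoOpt {L : Type} (l : Option L) (S : Store) :
    TM2.stepAux (gotoOpt l) false S = ⟨l, false, S⟩ := by
  cases l <;> rfl

theorem stepAux_test {L : Type} (k : Stk) (p : Option (Alph k) → Bool) (l l' : Option L)
    (S : Store) :
    TM2.stepAux (test k p l l') false S = ⟨if p (S k).head? then l else l', false, S⟩ := by
  cases h : p (S k).head? <;> simp [test, h, stepAux_gotoOpt]

/-- Running a machine for a given number of steps. -/
abbrev stepN {L : Type} (M : L → TM2.Stmt Alph L Bool) (t : ℕ) (x : TM2.Cfg Alph L Bool) :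
    Option (TM2.Cfg Alph L Bool) :=
  (flip Option.bind (TM2.step M))^[t] (some x)

theorem stepN_trans {L : Type} {M : L → TM2.Stmt Alph L Bool} {t u : ℕ}
    {x y z : TM2.Cfg Alph L Bool} (h : stepN M t x = some y) (h' : stepN M u y = some z) :
    stepN M (t + u) x = some z := by
  unfold stepN at *
  rw [add_comm, iterate_add_apply, h, h']

/-- The machine of a program does what the program does, in the same number of steps. -/
theorem stepN_code {c : Cmd} {S S' : Store} {t : ℕ} (h : Exec c S S' t) :
    ∀ {L : Type} (M : L → TM2.Stmt Alph L Bool) (emb : Lab c → L) (next : Option L),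
      (∀ l, M (emb l) = code c emb next l) →
        stepN M t ⟨some (emb (entry c)), false, S⟩ = some ⟨next, false, S'⟩ := by
  induction h with
  | push =>
    intro L M emb next hM
    simp [stepN, flip, TM2.step, hM, code, stepAux_gotoOpt]
  | pop =>
    intro L M emb next hM
    simp [stepN, flip, TM2.step, hM, code, stepAux_gotoOpt]
  | seq _ _ ih1 ih2 =>
    intro L M emb next hM
    exact stepN_trans (ih1 M _ _ fun l => hM (Sum.inl l)) (ih2 M _ _ fun l => hM (Sum.inr l))
  | ite_true hp _ ih =>
    intro L M emb next hM
    refine stepN_trans ?_ (ih M _ _ fun l => hM (some (Sum.inl l)))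
    have h0 := hM none
    simp only [code] at h0
    simp [stepN, flip, TM2.step, entry, h0, stepAux_test, hp]
  | ite_false hp _ ih =>
    intro L M emb next hM
    refine stepN_trans ?_ (ih M _ _ fun l => hM (some (Sum.inr l)))
    have h0 := hM none
    simp only [code] at h0
    simp [stepN, flip, TM2.step, entry, h0, stepAux_test, hp]
  | loop_done hp =>
    intro L M emb next hM
    have h0 := hM none
    simp only [code] at h0
    simp [stepN, flip, TM2.step, entry, h0, stepAux_test, hp]
  | loop_step hp _ _ ih1 ih2 =>
    intro L M emb next hM
    refine stepN_trans (stepN_trans ?_ (ih1 M _ _ fun l => hM (some l))) (ih2 M _ _ hM)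
    have h0 := hM none
    simp only [code] at h0
    simp [stepN, flip, TM2.step, entry, h0, stepAux_test, hp]

end Cmd

/-- The Turing machine of a program. -/
noncomputable def machine (c : Cmd) : FinTM2 :=
  haveI := Cmd.finite_lab c
  letI := Fintype.ofFinite (Cmd.Lab c)
  { K := Stk
    k₀ := .inp
    k₁ := .main
    Γ := Alph
    Λ := Cmd.Lab c
    main := Cmd.entry c
    σ := Bool
    initialState := false
    Γk₀Fin := inferInstanceAs (Fintype Γ')
    m := Cmd.code c id none }

/-- The store with the given contents. -/
def st (i r : List Γ') (m a b c : List Bool) : Store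
  | .inp => i
  | .rev => r
  | .main => m
  | .a => a
  | .b => b
  | .c => c

section update
variable (i r : List Γ') (m a b c : List Bool)

@[simp] theorem update_st_inp (x : List Γ') :
    update (st i r m a b c) .inp x = st x r m a b c := by funext k; cases k <;> rfl
@[simp] theorem update_st_rev (x : List Γ') :
    update (st i r m a b c) .rev x = st i x m a b c := by funext k; cases k <;> rfl
@[simp] theorem update_st_main (x : List Bool) :
    update (st i r m a b c) .main x = st i r x a b c := by funext k; cases k <;> rfl
@[simp] theorem update_st_a (x : List Bool) :
    update (st i r m a b c) .a x = st i r m x b c := by funext k; cases k <;> rfl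
@[simp] theorem update_st_b (x : List Bool) :
    update (st i r m a b c) .b x = st i r m a x c := by funext k; cases k <;> rfl
@[simp] theorem update_st_c (x : List Bool) :
    update (st i r m a b c) .c x = st i r m a b x := by funext k; cases k <;> rfl

@[simp] theorem st_inp : st i r m a b c .inp = i := rfl
@[simp] theorem st_rev : st i r m a b c .rev = r := rfl
@[simp] theorem st_main : st i r m a b c .main = m := rfl
@[simp] theorem st_a : st i r m a b c .a = a := rfl
@[simp] theorem st_b : st i r m a b c .b = b := rfl
@[simp] theorem st_c : st i r m a b c .c = c := rfl

end update

/-- A program that turns every encoded instance into the binary representation of the value,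
within a polynomial number of steps, puts the function into FP. -/
theorem inFP_of_exec {α : Type} {enc : α → List Γ'} {f : α → ℕ} (c : Cmd) (P : Polynomial ℕ)
    (h : ∀ x, ∃ t ≤ P.eval (enc x).length,
      Exec c (st (enc x) [] [] [] [] []) (st [] [] (encodeNat (f x)) [] [] []) t) :
    InFP enc f := by
  refine ⟨{ tm := machine c, inputAlphabet := Equiv.refl _, outputAlphabet := Equiv.refl _,
            time := P, outputsFun := fun x => ?_ }⟩
  have key : ∃ t ≤ P.eval (enc x).length,
      (flip Option.bind (machine c).step)^[t] (some (initList (machine c) (enc x))) =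
        some (haltList (machine c) (encodeNat (f x))) := by
    obtain ⟨t, ht, hx⟩ := h x
    refine ⟨t, ht, ?_⟩
    have := Cmd.stepN_code hx (Cmd.code c id none) id none fun _ => rfl
    have h1 : initList (machine c) (enc x) =
        (⟨some (Cmd.entry c), false, st (enc x) [] [] [] [] []⟩ : TM2.Cfg Alph (Cmd.Lab c) Bool) := by
      unfold initList
      congr 1
      funext k; cases k <;> rfl
    have h2 : haltList (machine c) (encodeNat (f x)) =
        (⟨none, false, st [] [] (encodeNat (f x)) [] [] []⟩ : TM2.Cfg Alph (Cmd.Lab c) Bool) := by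
      unfold haltList
      congr 1
      funext k; cases k <;> rfl
    rw [h1, h2]
    exact this
  -- Input and output are relabelled along the alphabet equivalences, which are identities here.
  have e1 : List.map (Equiv.refl Γ').invFun (enc x) = enc x := List.map_id _
  have e2 : List.map (Equiv.refl Bool).invFun (encodeNat (f x)) = encodeNat (f x) := List.map_id _
  exact
    { steps := key.choose
      evals_in_steps := by
        have := key.choose_spec.2
        erw [e1, e2]
        exact this
      steps_le_m := key.choose_spec.1 }

/-! ## Running programs within a time bound -/

/-- Started on `S`, the program `c` ends on `S'` after at most `n` steps. -/
def Runs (c : Cmd) (S S' : Store) (n : ℕ) : Prop := ∃ t ≤ n, Exec c S S' t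

namespace Runs
variable {c d : Cmd} {S S' S'' : Store} {n n' : ℕ} {k : Stk} {p : Option (Alph k) → Bool}

theorem mono (h : Runs c S S' n) (hn : n ≤ n') : Runs c S S' n' :=
  let ⟨t, ht, e⟩ := h
  ⟨t, ht.trans hn, e⟩

theorem push {x : Alph k} (h : update S k (x :: S k) = S') : Runs (.push k x) S S' 1 :=
  ⟨1, le_rfl, h ▸ .push⟩

theorem pop (h : update S k (S k).tail = S') : Runs (.pop k) S S' 1 :=
  ⟨1, le_rfl, h ▸ .pop⟩

theorem seq (h : Runs c S S' n) (h' : Runs d S' S'' n') : Runs (c ;; d) S S'' (n + n') := by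
  obtain ⟨t, ht, e⟩ := h
  obtain ⟨t', ht', e'⟩ := h'
  exact ⟨t + t', by omega, .seq e e'⟩

theorem ite_true (hp : p (S k).head? = true) (h : Runs c S S' n) :
    Runs (.ite k p c d) S S' (1 + n) :=
  let ⟨t, ht, e⟩ := h
  ⟨1 + t, by omega, .ite_true hp e⟩

theorem ite_false (hp : p (S k).head? = false) (h : Runs d S S' n) :
    Runs (.ite k p c d) S S' (1 + n) :=
  let ⟨t, ht, e⟩ := h
  ⟨1 + t, by omega, .ite_false hp e⟩

theorem loop_done (hp : p (S k).head? = false) : Runs (.loop k p c) S S 1 :=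
  ⟨1, le_rfl, .loop_done hp⟩

theorem loop_step (hp : p (S k).head? = true) (h : Runs c S S' n)
    (h' : Runs (.loop k p c) S' S'' n') : Runs (.loop k p c) S S'' (1 + n + n') := by
  obtain ⟨t, ht, e⟩ := h
  obtain ⟨t', ht', e'⟩ := h'
  exact ⟨1 + t + t', by omega, .loop_step hp e e'⟩

end Runs

/-! ## Binary trees as data -/

/-- Binary trees, the data of the programs. -/
inductive T
  | nil
  | cons (x y : T)
  deriving DecidableEq

namespace T

/-- The prefix code of a tree. -/
def code : T → List Bool
  | nil => [false]
  | cons x y => true :: (code x ++ code y)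

/-- The size of a tree is the length of its code. -/
def size : T → ℕ
  | nil => 1
  | cons x y => 1 + size x + size y

@[simp] theorem length_code (x : T) : x.code.length = x.size := by
  induction x with
  | nil => rfl
  | cons x y hx hy => simp [code, size, hx, hy]; omega

theorem size_pos (x : T) : 0 < x.size := by cases x <;> simp [size]

/-- A prefix code can be decoded from the front. Hence trees may be stacked without separators and
compared through their bit strings. -/
theorem code_append_inj : ∀ {x y : T} {l l' : List Bool},
    x.code ++ l = y.code ++ l' → x = y ∧ l = l'
  | nil, nil, _, _, h => by simpa [code] using h
  | nil, cons _ _, _, _, h => by simp [code] at h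
  | cons _ _, nil, _, _, h => by simp [code] at h
  | cons x x', cons y y', l, l', h => by
      simp only [code, List.cons_append, List.append_assoc, List.cons.injEq, true_and] at h
      obtain ⟨h1, h⟩ := code_append_inj h
      obtain ⟨h2, h⟩ := code_append_inj h
      exact ⟨by rw [h1, h2], h⟩

theorem code_injective : Injective code := fun x y h =>
  (code_append_inj (l := []) (l' := []) (by simpa using h)).1

/-- The left subtree. -/
def car : T → T
  | nil => nil
  | cons x _ => x

/-- The right subtree. -/
def cdr : T → T
  | nil => nil
  | cons _ y => y

end T

/-! ## Moving trees between stacks -/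

section moves
variable (i r : List Γ') (m a b c : List Bool)

/-- Move the top tree of the data stack to the first scratch stack, in reverse. -/
def takeA : Cmd :=
  .push .c true ;; .loop .c Option.isSome (.ite .main (· == some true)
    (.pop .main ;; .push .a true ;; .push .c true) (.pop .main ;; .push .a false ;; .pop .c))

/-- Move the top tree of the data stack to the second scratch stack, in reverse. -/
def takeB : Cmd :=
  .push .c true ;; .loop .c Option.isSome (.ite .main (· == some true)
    (.pop .main ;; .push .b true ;; .push .c true) (.pop .main ;; .push .b false ;; .pop .c))

/-- The stack `c` counts in unary the subtrees still to be read: an inner node consumes one and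
opens two, a leaf closes one. `key` is stated with the rest of the run as a hypothesis, so that the
two subtrees of a node can be chained. -/
theorem runs_takeA (x : T) :
    Runs takeA (st i r (x.code ++ m) a b []) (st i r m (x.code.reverse ++ a) b [])
      (5 * x.size + 2) := by
  have key : ∀ (x : T) (m a c : List Bool) (S' : Store) (n : ℕ),
      Runs (.loop .c Option.isSome (.ite .main (· == some true)
        (.pop .main ;; .push .a true ;; .push .c true)
        (.pop .main ;; .push .a false ;; .pop .c))) (st i r m (x.code.reverse ++ a) b c) S' n →
      Runs (.loop .c Option.isSome (.ite .main (· == some true)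
        (.pop .main ;; .push .a true ;; .push .c true)
        (.pop .main ;; .push .a false ;; .pop .c)))
        (st i r (x.code ++ m) a b (true :: c)) S' (5 * x.size + n) := by
    intro x
    induction x with
    | nil =>
      intro m a c S' n h
      refine Runs.mono (.loop_step (S' := st i r m (false :: a) b c) rfl (.ite_false rfl
        (.seq (.pop rfl) (.seq (.push rfl) (.pop ?_)))) (by simpa [T.code] using h)) ?_
      · simp [T.code]
      · simp [T.size]
    | cons x y hx hy =>
      intro m a c S' n h
      have h1 := hx (y.code ++ m) (true :: a) (true :: c) S' _
        (hy m (x.code.reverse ++ true :: a) c S' n (by simpa [T.code] using h))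
      refine Runs.mono (.loop_step
        (S' := st i r (x.code ++ (y.code ++ m)) (true :: a) b (true :: true :: c)) rfl
        (.ite_true rfl (.seq (.pop rfl) (.seq (.push rfl) (.push ?_)))) h1) ?_
      · simp [T.code]
      · simp [T.size]; omega
  refine Runs.mono (.seq (.push ?_) (key x m a [] _ 1 (.loop_done rfl))) ?_
  · simp
  · omega

theorem runs_takeB (x : T) :
    Runs takeB (st i r (x.code ++ m) a b []) (st i r m a (x.code.reverse ++ b) [])
      (5 * x.size + 2) := by
  have key : ∀ (x : T) (m b c : List Bool) (S' : Store) (n : ℕ),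
      Runs (.loop .c Option.isSome (.ite .main (· == some true)
        (.pop .main ;; .push .b true ;; .push .c true)
        (.pop .main ;; .push .b false ;; .pop .c))) (st i r m a (x.code.reverse ++ b) c) S' n →
      Runs (.loop .c Option.isSome (.ite .main (· == some true)
        (.pop .main ;; .push .b true ;; .push .c true)
        (.pop .main ;; .push .b false ;; .pop .c)))
        (st i r (x.code ++ m) a b (true :: c)) S' (5 * x.size + n) := by
    intro x
    induction x with
    | nil =>
      intro m b c S' n h
      refine Runs.mono (.loop_step (S' := st i r m a (false :: b) c) rfl (.ite_false rfl
        (.seq (.pop rfl) (.seq (.push rfl) (.pop ?_)))) (by simpa [T.code] using h)) ?_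
      · simp [T.code]
      · simp [T.size]
    | cons x y hx hy =>
      intro m b c S' n h
      have h1 := hx (y.code ++ m) (true :: b) (true :: c) S' _
        (hy m (x.code.reverse ++ true :: b) c S' n (by simpa [T.code] using h))
      refine Runs.mono (.loop_step
        (S' := st i r (x.code ++ (y.code ++ m)) a (true :: b) (true :: true :: c)) rfl
        (.ite_true rfl (.seq (.pop rfl) (.seq (.push rfl) (.push ?_)))) h1) ?_
      · simp [T.code]
      · simp [T.size]; omega
  refine Runs.mono (.seq (.push ?_) (key x m b [] _ 1 (.loop_done rfl))) ?_
  · simp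
  · omega

/-- Move the first scratch stack to the data stack. -/
def putA : Cmd :=
  .loop .a Option.isSome (.ite .a (· == some true)
    (.pop .a ;; .push .main true) (.pop .a ;; .push .main false))

/-- Move the second scratch stack to the data stack. -/
def putB : Cmd :=
  .loop .b Option.isSome (.ite .b (· == some true)
    (.pop .b ;; .push .main true) (.pop .b ;; .push .main false))

/-- Move the second scratch stack to the first one. -/
def moveBA : Cmd :=
  .loop .b Option.isSome (.ite .b (· == some true)
    (.pop .b ;; .push .a true) (.pop .b ;; .push .a false))

/-- Move the first scratch stack to the data stack and to the second scratch stack. -/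
def copyA : Cmd :=
  .loop .a Option.isSome (.ite .a (· == some true)
    (.pop .a ;; .push .main true ;; .push .b true)
    (.pop .a ;; .push .main false ;; .push .b false))

theorem runs_putA : Runs putA (st i r m a b c) (st i r (a.reverse ++ m) [] b c)
    (4 * a.length + 1) := by
  unfold putA
  induction a generalizing m with
  | nil => exact .loop_done rfl
  | cons x a ih =>
    refine Runs.mono (.loop_step (S' := st i r (x :: m) a b c) (n := 3) rfl ?_
      (by simpa using ih (x :: m))) (by simp; omega)
    cases x
    · exact .ite_false rfl (.seq (.pop rfl) (.push (by simp)))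
    · exact .ite_true rfl (.seq (.pop rfl) (.push (by simp)))

theorem runs_putB : Runs putB (st i r m a b c) (st i r (b.reverse ++ m) a [] c)
    (4 * b.length + 1) := by
  unfold putB
  induction b generalizing m with
  | nil => exact .loop_done rfl
  | cons x b ih =>
    refine Runs.mono (.loop_step (S' := st i r (x :: m) a b c) (n := 3) rfl ?_
      (by simpa using ih (x :: m))) (by simp; omega)
    cases x
    · exact .ite_false rfl (.seq (.pop rfl) (.push (by simp)))
    · exact .ite_true rfl (.seq (.pop rfl) (.push (by simp)))

theorem runs_moveBA : Runs moveBA (st i r m a b c) (st i r m (b.reverse ++ a) [] c)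
    (4 * b.length + 1) := by
  unfold moveBA
  induction b generalizing a with
  | nil => exact .loop_done rfl
  | cons x b ih =>
    refine Runs.mono (.loop_step (S' := st i r m (x :: a) b c) (n := 3) rfl ?_
      (by simpa using ih (x :: a))) (by simp; omega)
    cases x
    · exact .ite_false rfl (.seq (.pop rfl) (.push (by simp)))
    · exact .ite_true rfl (.seq (.pop rfl) (.push (by simp)))

theorem runs_copyA : Runs copyA (st i r m a b c)
    (st i r (a.reverse ++ m) [] (a.reverse ++ b) c) (5 * a.length + 1) := by
  unfold copyA
  induction a generalizing m b with
  | nil => exact .loop_done rfl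
  | cons x a ih =>
    refine Runs.mono (.loop_step (S' := st i r (x :: m) a (x :: b) c) (n := 4) rfl ?_
      (by simpa using ih (x :: m) (x :: b))) (by simp; omega)
    cases x
    · exact .ite_false rfl (.seq (.pop rfl) (.seq (.push rfl) (.push (by simp))))
    · exact .ite_true rfl (.seq (.pop rfl) (.seq (.push rfl) (.push (by simp))))

/-- Duplicate the top tree. -/
def dup : Cmd := takeA ;; copyA ;; moveBA ;; putA

/-- Swap the two top trees. -/
def swap : Cmd := takeA ;; takeB ;; putA ;; putB

/-- Remove the top tree. -/
def drop : Cmd := takeA ;; .loop .a Option.isSome (.pop .a)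

/-- Every transfer between stacks reverses the string. The second copy reaches `b` unreversed, and
the detour through `a` lets it arrive on the data stack in the right order. -/
theorem runs_dup (x : T) : Runs dup (st i r (x.code ++ m) [] [] [])
    (st i r (x.code ++ (x.code ++ m)) [] [] []) (20 * x.size + 10) := by
  have h1 := runs_takeA i r m [] [] x
  have h2 := runs_copyA i r m (x.code.reverse ++ []) [] []
  have h3 := runs_moveBA i r (x.code ++ m) [] x.code []
  have h4 := runs_putA i r (x.code ++ m) x.code.reverse [] []
  simp only [List.append_nil, List.reverse_reverse, List.length_reverse, T.length_code]
    at h1 h2 h3 h4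
  exact (h1.seq (h2.seq (h3.seq h4))).mono (by omega)

theorem runs_swap (x y : T) : Runs swap (st i r (x.code ++ (y.code ++ m)) [] [] [])
    (st i r (y.code ++ (x.code ++ m)) [] [] []) (10 * (x.size + y.size) + 10) := by
  have h1 := runs_takeA i r (y.code ++ m) [] [] x
  have h2 := runs_takeB i r m x.code.reverse [] y
  have h3 := runs_putA i r m x.code.reverse y.code.reverse []
  have h4 := runs_putB i r (x.code ++ m) [] y.code.reverse []
  simp only [List.append_nil, List.reverse_reverse, List.length_reverse, T.length_code]
    at h1 h2 h3 h4
  exact (h1.seq (h2.seq (h3.seq h4))).mono (by omega)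

theorem runs_drop (x : T) : Runs drop (st i r (x.code ++ m) [] [] []) (st i r m [] [] [])
    (10 * x.size + 10) := by
  have key : ∀ a, Runs (.loop .a Option.isSome (.pop .a)) (st i r m a [] [])
      (st i r m [] [] []) (2 * a.length + 1) := by
    intro a
    induction a with
    | nil => exact .loop_done rfl
    | cons x a ih => exact Runs.mono (.loop_step rfl (.pop (by simp)) ih) (by simp; omega)
  have h1 := runs_takeA i r m [] [] x
  have h2 := key x.code.reverse
  simp only [List.append_nil, List.length_reverse, T.length_code] at h1 h2
  exact (h1.seq h2).mono (by omega)

/-- Compare the contents of the scratch stacks, clear them, and push the verdict. -/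
def cmpAB : Cmd :=
  .loop .a Option.isSome
    (.ite .a (· == some true)
      (.ite .b (· == some true) (.pop .a) (.pop .a ;; .push .c true))
      (.ite .b (· == some false) (.pop .a) (.pop .a ;; .push .c true)) ;; .pop .b) ;;
  .loop .b Option.isSome (.pop .b ;; .push .c true) ;;
  .push .main false ;;
  .ite .c Option.isSome (.loop .c Option.isSome (.pop .c))
    (.push .main false ;; .push .main true)

/-- The tree of a Boolean. -/
def T.ofBool : Bool → T
  | false => .nil
  | true => .cons .nil .nil

/-- The stack `c` records mismatches, including symbols left over on `b`, so it ends empty exactly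
if the strings agree. Popping an exhausted `b` is harmless. The bit `false` pushed afterwards is
already the negative verdict; two more bits in front turn it into the positive one. -/
theorem runs_cmpAB : Runs cmpAB (st i r m a b [])
    (st i r ((T.ofBool (decide (a = b))).code ++ m) [] [] [])
      (20 * (a.length + b.length) + 20) := by
  have clear : ∀ m c, Runs (.loop .c Option.isSome (.pop .c)) (st i r m [] [] c)
      (st i r m [] [] []) (2 * c.length + 1) := by
    intro m c
    induction c with
    | nil => exact .loop_done rfl
    | cons x c ih => exact Runs.mono (.loop_step rfl (.pop (by simp)) ih) (by simp; omega)
  have h2 : ∀ b c, ∃ c', (c' = [] ↔ c = [] ∧ b = []) ∧ c'.length ≤ c.length + b.length ∧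
      Runs (.loop .b Option.isSome (.pop .b ;; .push .c true)) (st i r m [] b c)
        (st i r m [] [] c') (3 * b.length + 1) := by
    intro b
    induction b with
    | nil => exact fun c => ⟨c, by simp, by simp, .loop_done rfl⟩
    | cons x b ih =>
      intro c
      obtain ⟨c', e, hl, h⟩ := ih (true :: c)
      refine ⟨c', by simp [e], by simp at hl ⊢; omega, ?_⟩
      exact Runs.mono (.loop_step rfl (.seq (.pop rfl) (.push (by simp))) h) (by simp; omega)
  have h1 : ∀ a b c, ∃ b' c', (c' = [] ∧ b' = [] ↔ c = [] ∧ a = b) ∧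
      c'.length ≤ c.length + a.length ∧ b'.length ≤ b.length ∧
      Runs (.loop .a Option.isSome
        (.ite .a (· == some true)
          (.ite .b (· == some true) (.pop .a) (.pop .a ;; .push .c true))
          (.ite .b (· == some false) (.pop .a) (.pop .a ;; .push .c true)) ;; .pop .b))
        (st i r m a b c) (st i r m [] b' c') (6 * a.length + 1) := by
    intro a
    induction a with
    | nil =>
      exact fun b c => ⟨b, c, by simp [eq_comm], by simp, by simp, .loop_done rfl⟩
    | cons x a ih =>
      intro b c
      by_cases hb : b.head? = some x
      · obtain ⟨b', c', e, hl, hl', h⟩ := ih b.tail c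
        refine ⟨b', c', ?_, by simp at hl ⊢; omega, by simp at hl' ⊢; omega, ?_⟩
        · rw [e]
          cases b <;> simp_all [eq_comm]
        · refine Runs.mono (.loop_step (S' := st i r m a b.tail c) rfl
            (.seq (n := 3) (n' := 1) (S' := st i r m a b c) ?_ (.pop (by simp))) h)
            (by simp; omega)
          cases x
          · exact Runs.mono (.ite_false rfl (.ite_true (by simp [hb]) (.pop (by simp))))
              (by omega)
          · exact Runs.mono (.ite_true rfl (.ite_true (by simp [hb]) (.pop (by simp))))
              (by omega)
      · obtain ⟨b', c', e, hl, hl', h⟩ := ih b.tail (true :: c)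
        refine ⟨b', c', ?_, by simp at hl ⊢; omega, by simp at hl' ⊢; omega, ?_⟩
        · rw [e]
          cases b <;> simp_all [eq_comm]
        · refine Runs.mono (.loop_step (S' := st i r m a b.tail (true :: c)) rfl
            (.seq (n := 4) (n' := 1) (S' := st i r m a b (true :: c)) ?_ (.pop (by simp))) h)
            (by simp; omega)
          cases x
          · exact Runs.mono (.ite_false rfl (.ite_false (by simpa using hb)
              (.seq (.pop rfl) (.push (by simp))))) (by omega)
          · exact Runs.mono (.ite_true rfl (.ite_false (by simpa using hb)
              (.seq (.pop rfl) (.push (by simp))))) (by omega)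
  obtain ⟨b', c', e, hl, hl', h⟩ := h1 a b []
  obtain ⟨c'', e', hl'', h'⟩ := h2 b' c'
  have hc : c'' = [] ↔ a = b := by simp [e', e]
  simp only [List.length_nil, zero_add] at hl
  by_cases hab : a = b
  · have := hc.2 hab
    subst this
    refine Runs.mono (h.seq (h'.seq (.seq (.push rfl) (.ite_false rfl
      (.seq (.push rfl) (.push ?_)))))) (by omega)
    simp [hab, T.ofBool, T.code]
  · have hne : c'' ≠ [] := fun h => hab (hc.1 h)
    refine Runs.mono (h.seq (h'.seq (.seq (S' := st i r (false :: m) [] [] c'') (.push (by simp))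
      (.ite_true ?_ (n := 2 * c''.length + 1) ?_)))) (by omega)
    · cases c'' <;> simp_all
    · simpa [hab, T.ofBool, T.code] using clear (false :: m) c''

/-- Replace the two top trees by the verdict whether they are equal. -/
def cmp : Cmd := takeA ;; takeB ;; cmpAB

theorem runs_cmp (x y : T) : Runs cmp (st i r (x.code ++ (y.code ++ m)) [] [] [])
    (st i r ((T.ofBool (decide (x = y))).code ++ m) [] [] [])
      (25 * (x.size + y.size) + 30) := by
  have h1 := runs_takeA i r (y.code ++ m) [] [] x
  have h2 := runs_takeB i r m x.code.reverse [] y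
  have h3 := runs_cmpAB i r m x.code.reverse y.code.reverse
  simp only [List.append_nil, List.reverse_inj, T.code_injective.eq_iff, List.length_reverse,
    T.length_code] at h1 h2 h3
  exact (h1.seq (h2.seq h3)).mono (by omega)

end moves

/-! ## Polynomial-time transformations of trees -/

/-- Coefficients in `ℕ` are nonnegative. This is what allows size and time bounds to be substituted
into each other. -/
theorem eval_mono (P : Polynomial ℕ) {m n : ℕ} (h : m ≤ n) : P.eval m ≤ P.eval n := by
  rw [Polynomial.eval_eq_sum_range, Polynomial.eval_eq_sum_range]
  gcongr

/-- Some program turns the tree `e x` into the tree `g x`, for every `x`, in time polynomial in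
the size of `e x`. -/
def PT {α : Type} (e g : α → T) : Prop :=
  ∃ (c : Cmd) (P : Polynomial ℕ), ∀ x, (g x).size ≤ P.eval (e x).size ∧
    ∀ i r m, Runs c (st i r ((e x).code ++ m) [] [] []) (st i r ((g x).code ++ m) [] [] [])
      (P.eval (e x).size)

namespace PT
variable {α β : Type} {e f g : α → T}

theorem mk' (c : Cmd) (P Q : Polynomial ℕ) (hs : ∀ x, (g x).size ≤ P.eval (e x).size)
    (hr : ∀ x i r m, Runs c (st i r ((e x).code ++ m) [] [] [])
      (st i r ((g x).code ++ m) [] [] []) (Q.eval (e x).size)) : PT e g :=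
  ⟨c, P + Q, fun x => ⟨by simpa using (hs x).trans (Nat.le_add_right _ _),
    fun i r m => (hr x i r m).mono (by simp)⟩⟩

/-- There is no empty program; a push undone by a pop serves as one. -/
theorem refl (e : α → T) : PT e e :=
  mk' (.push .main true ;; .pop .main) .X 2 (fun x => by simp)
    fun x i r m => Runs.mono (.seq (.push rfl) (.pop (by simp))) (by simp)

/-- The size bound that is part of `PT` guarantees that the second program starts on a tree of
polynomial size. -/
theorem trans (h : PT e f) (h' : PT f g) : PT e g := by
  obtain ⟨c, P, h⟩ := h
  obtain ⟨d, Q, h'⟩ := h'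
  refine mk' (c ;; d) (Q.comp P) (P + Q.comp P) (fun x => ?_) fun x i r m => ?_
  · simpa using (h' x).1.trans (eval_mono Q (h x).1)
  · refine (((h x).2 i r m).seq ((h' x).2 i r m)).mono ?_
    simpa using eval_mono Q (h x).1

/-- One program serves all indices, so it also serves any family of them. This is used to restrict
to a case and to apply a program to computed arguments. -/
theorem reindex (φ : β → α) (h : PT e g) : PT (fun y => e (φ y)) (fun y => g (φ y)) :=
  let ⟨c, P, h⟩ := h
  ⟨c, P, fun y => h (φ y)⟩

theorem congr {e' g' : α → T} (h : PT e g) (he : ∀ x, e x = e' x) (hg : ∀ x, g x = g' x) :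
    PT e' g' := by
  obtain rfl : e = e' := funext he
  obtain rfl : g = g' := funext hg
  exact h

/-- Since programs leave the stack below their argument alone, one result can wait there while the
other is computed from a copy of the input. -/
theorem cons (h : PT e f) (h' : PT e g) : PT e (fun x => .cons (f x) (g x)) := by
  obtain ⟨c, P, h⟩ := h
  obtain ⟨d, Q, h'⟩ := h'
  refine mk' (dup ;; c ;; swap ;; d ;; swap ;; .push .main true) (1 + P + Q)
    (30 * .X + 41 + 11 * P + P + 11 * Q + 10 * P) (fun x => ?_) fun x i r m => ?_
  · have h1 := (h x).1
    have h2 := (h' x).1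
    simp [T.size]; omega
  · have h1 := (h x).1
    have h2 := (h' x).1
    refine Runs.mono ((runs_dup i r m (e x)).seq (((h x).2 i r _).seq
      ((runs_swap i r m (f x) (e x)).seq (((h' x).2 i r _).seq
      ((runs_swap i r m (g x) (f x)).seq (.push ?_)))))) ?_
    · simp [T.code]
    · simp; omega

theorem nil : PT e (fun _ => .nil) :=
  mk' (drop ;; .push .main false) 1 (10 * .X + 11) (fun x => by simp [T.size])
    fun x i r m => Runs.mono ((runs_drop i r m (e x)).seq (.push (by simp [T.code]))) (by simp)

theorem const : ∀ t : T, PT e (fun _ => t)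
  | .nil => nil
  | .cons x y => cons (const x) (const y)

theorem car (h : PT e f) : PT e (fun x => (f x).car) := by
  refine trans h (reindex (e := id) (g := T.car) f ?_)
  refine mk' (.ite .main (· == some true) (.pop .main ;; swap ;; drop)
    (.push .main true ;; .pop .main)) .X (20 * .X + 30) (fun x => ?_) fun x i r m => ?_
  · cases x <;> simp [T.size, T.car]; omega
  · cases x with
    | nil =>
      exact Runs.mono (.ite_false (by simp [T.code]) (.seq (.push rfl)
        (.pop (by simp [T.car])))) (by simp)
    | cons x y =>
      refine Runs.mono (.ite_true (by simp [T.code]) (.seq (S' := st i r (x.code ++ (y.code ++ m)) [] [] [])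
        (.pop (by simp [T.code])) ((runs_swap i r m x y).seq (runs_drop i r _ y)))) ?_
      simp [T.size]; omega

theorem cdr (h : PT e f) : PT e (fun x => (f x).cdr) := by
  refine trans h (reindex (e := id) (g := T.cdr) f ?_)
  refine mk' (.ite .main (· == some true) (.pop .main ;; drop)
    (.push .main true ;; .pop .main)) .X (20 * .X + 30) (fun x => ?_) fun x i r m => ?_
  · cases x <;> simp [T.size, T.cdr]
  · cases x with
    | nil =>
      exact Runs.mono (.ite_false (by simp [T.code]) (.seq (.push rfl)
        (.pop (by simp [T.cdr])))) (by simp)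
    | cons x y =>
      refine Runs.mono (.ite_true (by simp [T.code]) (.seq (S' := st i r (x.code ++ (y.code ++ m)) [] [] [])
        (.pop (by simp [T.code])) (runs_drop i r _ x))) ?_
      simp [T.size]; omega

theorem eq (h : PT e f) (h' : PT e g) : PT e (fun x => T.ofBool (decide (f x = g x))) := by
  refine trans (cons h h') (reindex (e := fun p : T × T => .cons p.1 p.2)
    (g := fun p => T.ofBool (decide (p.1 = p.2))) (fun x => (f x, g x)) ?_)
  refine mk' (.pop .main ;; cmp) 3 (25 * .X + 31) (fun x => ?_) fun x i r m => ?_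
  · simp only [Polynomial.eval_ofNat]
    cases decide (x.1 = x.2) <;> simp [T.ofBool, T.size]
  · refine Runs.mono (.seq (S' := st i r (x.1.code ++ (x.2.code ++ m)) [] [] [])
      (.pop (by simp [T.code])) (runs_cmp i r m x.1 x.2)) ?_
    simp [T.size]; omega

/-- Case distinction on whether the tree `u x` is empty. -/
theorem cases {u : α → T} (hu : PT e u)
    (hf : PT (fun x : {x // u x = .nil} => e x) (fun x => g x))
    (hg : PT (fun x : {x // u x ≠ .nil} => .cons (u x) (e x)) (fun x => g x)) : PT e g := by
  refine trans (cons hu (refl e)) ?_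
  obtain ⟨c, P, hf⟩ := hf
  obtain ⟨d, Q, hg⟩ := hg
  -- Without the constructor bit of the pair, the top bit is the first bit of `u x` and tells
  -- whether this tree is empty. If not, the bit is restored and the branch receives the pair;
  -- otherwise the one-bit code of `u x` is removed.
  refine mk' (.pop .main ;; .ite .main (· == some true) (.push .main true ;; d)
    (.pop .main ;; c)) (P + Q) (P + Q + 3) (fun x => ?_) fun x i r m => ?_
  · by_cases h : u x = .nil
    · refine (hf ⟨x, h⟩).1.trans ?_
      simpa using (eval_mono P (by simp [T.size])).trans (Nat.le_add_right _ _)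
    · refine (hg ⟨x, h⟩).1.trans ?_
      simp
  · by_cases h : u x = .nil
    · refine Runs.mono (.seq (.pop rfl) (.ite_false ?_ (.seq (S' := st i r ((e x).code ++ m) [] [] [])
        (.pop ?_) ((hf ⟨x, h⟩).2 i r m)))) ?_
      · simp [h, T.code]
      · simp [h, T.code]
      · have := eval_mono P (show (e x).size ≤ (T.cons (u x) (e x)).size by simp [T.size])
        simp at this ⊢; omega
    · refine Runs.mono (.seq (.pop rfl) (.ite_true ?_
        (.seq (.push (by simp; rfl)) ((hg ⟨x, h⟩).2 i r m)))) ?_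
      · cases hx : u x
        · exact absurd hx h
        · simp [T.code]
      · simp; omega

/-- Iteration of a transformation as long as the tree `u y` is not empty. -/
theorem iterate {u w : β → T} {φ : β → β} {b : α → β} {N : α → ℕ} (P : Polynomial ℕ)
    (hb : PT e (fun x => .cons (u (b x)) (w (b x))))
    (hφ : PT (fun y : {y // u y ≠ .nil} => .cons (u y) (w y))
      (fun y => .cons (u (φ y)) (w (φ y))))
    (hN : ∀ x, N x ≤ P.eval (e x).size)
    (hs : ∀ x, ∀ n ≤ N x, (u (φ^[n] (b x))).size + (w (φ^[n] (b x))).size ≤ P.eval (e x).size)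
    (hlt : ∀ x, ∀ n < N x, u (φ^[n] (b x)) ≠ .nil)
    (hend : ∀ x, u (φ^[N x] (b x)) = .nil) :
    PT e (fun x => w (φ^[N x] (b x))) := by
  obtain ⟨c, Q, hb⟩ := hb
  obtain ⟨d, R, hφ⟩ := hφ
  -- Between rounds the pair lies on the stack without its constructor bit, which exposes the first
  -- bit of `u` to the loop test. `P` bounds both the number of rounds and the sizes, whence the
  -- product in the time bound.
  refine mk' (c ;; .pop .main ;; .loop .main (· == some true)
    (.push .main true ;; d ;; .pop .main) ;; .pop .main) P
    (Q + P * (R.comp (P + 1) + 3) + 3) (fun x => ?_) fun x i r m => ?_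
  · exact le_trans (by omega) (hs x (N x) le_rfl)
  · have key : ∀ k n, n + k = N x → Runs (.loop .main (· == some true)
        (.push .main true ;; d ;; .pop .main))
        (st i r ((u (φ^[n] (b x))).code ++ ((w (φ^[n] (b x))).code ++ m)) [] [] [])
        (st i r ((u (φ^[N x] (b x))).code ++ ((w (φ^[N x] (b x))).code ++ m)) [] [] [])
        (k * (R.eval (P.eval (e x).size + 1) + 3) + 1) := by
      intro k
      induction k with
      | zero =>
        rintro n rfl
        refine Runs.mono (.loop_done ?_) (by simp)
        simp [hend, T.code]
      | succ k ih =>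
        intro n hn
        have hne := hlt x n (by omega)
        have h1 := (hφ ⟨φ^[n] (b x), hne⟩).2 i r m
        have h2 := ih (n + 1) (by omega)
        rw [iterate_succ_apply'] at h2
        refine Runs.mono (.loop_step ?_ (.seq (.push ?_) (h1.seq (.pop ?_))) h2) ?_
        · cases hx : u (φ^[n] (b x))
          · exact absurd hx hne
          · simp [T.code]
        · simp [T.code]
        · simp [T.code]
        · have h3 := eval_mono R (show (T.cons (u (φ^[n] (b x))) (w (φ^[n] (b x)))).size ≤
            P.eval (e x).size + 1 by have := hs x n (by omega); simp [T.size]; omega)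
          simp only at h3 ⊢
          rw [Nat.succ_mul]
          omega
    refine Runs.mono (((hb x).2 i r m).seq (.seq (.pop ?_) ((key (N x) 0 (by simp)).seq
      (.pop ?_)))) ?_
    · simp [T.code]
    · simp [hend, T.code]
    · have := Nat.mul_le_mul_right (R.eval (P.eval (e x).size + 1) + 3) (hN x)
      simp only [Polynomial.eval_add, Polynomial.eval_mul, Polynomial.eval_comp,
        Polynomial.eval_one, Polynomial.eval_ofNat]
      omega

end PT

/-! ## Polynomial-time functions between types of data -/

/-- Data of type `α` are written as trees. -/
class Enc (α : Type) where
  enc : α → T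

open Enc (enc)

/-- Distinct data are written as distinct trees. -/
class EncInj (α : Type) [Enc α] : Prop where
  inj : Injective (enc : α → T)

/-- The size of the tree of a datum. -/
def sz {α : Type} [Enc α] (x : α) : ℕ := (enc x).size

instance : Enc Unit := ⟨fun _ => .nil⟩

instance : Enc Bool := ⟨T.ofBool⟩

instance {α β : Type} [Enc α] [Enc β] : Enc (α × β) := ⟨fun x => .cons (enc x.1) (enc x.2)⟩

instance {α β : Type} [Enc α] [Enc β] : Enc (α ⊕ β) :=
  ⟨Sum.elim (fun x => .cons .nil (enc x)) fun y => .cons (.cons .nil .nil) (enc y)⟩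

instance {α : Type} [Enc α] : Enc (List α) := ⟨fun l => l.foldr (fun x t => .cons (enc x) t) .nil⟩

/-- Natural numbers are written in unary. -/
instance : Enc ℕ := ⟨fun n => enc (List.replicate n ())⟩

section enc
variable {α β : Type} [Enc α] [Enc β]

theorem enc_nil : enc ([] : List α) = .nil := rfl

theorem enc_cons (x : α) (l : List α) : enc (x :: l) = .cons (enc x) (enc l) := rfl

theorem enc_list_eq_nil {l : List α} : enc l = .nil ↔ l = [] := by
  cases l <;> simp [enc_nil, enc_cons]

theorem sz_pos (x : α) : 0 < sz x := T.size_pos _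

@[simp] theorem sz_pair (x : α) (y : β) : sz (x, y) = 1 + sz x + sz y := rfl

@[simp] theorem sz_nil : sz ([] : List α) = 1 := rfl

@[simp] theorem sz_cons (x : α) (l : List α) : sz (x :: l) = 1 + sz x + sz l := rfl

theorem sz_bool (b : Bool) : sz b ≤ 3 := by cases b <;> simp [sz, enc, T.ofBool, T.size]

@[simp] theorem sz_unit (x : Unit) : sz x = 1 := rfl

theorem sz_append (l l' : List α) : sz (l ++ l') + 1 = sz l + sz l' := by
  induction l with
  | nil => simp; omega
  | cons x l ih => simp; omega

@[simp] theorem sz_reverse (l : List α) : sz l.reverse = sz l := by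
  induction l with
  | nil => rfl
  | cons x l ih => have := sz_append l.reverse [x]; simp at *; omega

theorem sz_mem {x : α} {l : List α} (h : x ∈ l) : sz x < sz l := by
  induction l with
  | nil => simp at h
  | cons y l ih =>
    have := sz_pos y
    rcases List.mem_cons.1 h with rfl | h
    · simp; omega
    · have := ih h; simp; omega

theorem length_lt_sz (l : List α) : l.length < sz l := by
  induction l with
  | nil => simp
  | cons y l ih => simp; omega

theorem sz_list_le {l : List α} {B : ℕ} (h : ∀ x ∈ l, sz x ≤ B) :
    sz l ≤ 1 + l.length * (1 + B) := by
  induction l with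
  | nil => simp
  | cons y l ih =>
    have h1 := ih fun x hx => h x (by simp [hx])
    have h2 := h y (by simp)
    simp only [sz_cons, List.length_cons, Nat.succ_mul]
    omega

theorem sz_prefix_le {l l' : List α} (h : l <+: l') : sz l ≤ sz l' := by
  obtain ⟨t, rfl⟩ := h
  have := sz_append l t
  have := sz_pos t
  omega

theorem sz_suffix_le {l l' : List α} (h : l <:+ l') : sz l ≤ sz l' := by
  obtain ⟨t, rfl⟩ := h
  have := sz_append t l
  have := sz_pos t
  omega

theorem sz_nat (n : ℕ) : sz n = 2 * n + 1 := by
  change sz (List.replicate n ()) = _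
  induction n with
  | zero => rfl
  | succ n ih => simp [List.replicate_succ, ih]; omega

end enc

instance : EncInj Bool := ⟨fun x y h => by cases x <;> cases y <;> simp_all [enc, T.ofBool]⟩

instance : EncInj Unit := ⟨fun _ _ _ => rfl⟩

instance {α β : Type} [Enc α] [Enc β] [EncInj α] [EncInj β] : EncInj (α × β) :=
  ⟨fun x y h => by
    simp only [enc, T.cons.injEq] at h
    exact Prod.ext (EncInj.inj h.1) (EncInj.inj h.2)⟩

instance {α : Type} [Enc α] [EncInj α] : EncInj (List α) := ⟨fun l => by
  induction l with
  | nil => intro l' h; exact (enc_list_eq_nil.1 h.symm).symm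
  | cons x l ih =>
    intro l' h
    cases l' with
    | nil => exact enc_list_eq_nil.1 h
    | cons y l' =>
      simp only [enc_cons, T.cons.injEq] at h
      rw [EncInj.inj h.1, ih h.2]⟩

instance : EncInj ℕ := ⟨fun m n h => by
  simpa using congrArg List.length (EncInj.inj (α := List Unit) h)⟩

/-- The function `f` is computed by a program in polynomial time. -/
def Poly {α β : Type} [Enc α] [Enc β] (f : α → β) : Prop :=
  PT (enc : α → T) (fun x => enc (f x))

namespace Poly
variable {α β γ σ : Type} [Enc α] [Enc β] [Enc γ] [Enc σ]

theorem of_eq {f g : α → β} (h : Poly f) (hfg : ∀ x, f x = g x) : Poly g :=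
  (funext hfg : f = g) ▸ h

theorem id : Poly (fun x : α => x) := PT.refl _

theorem const (y : β) : Poly (fun _ : α => y) := PT.const _

theorem comp {g : β → γ} {f : α → β} (hg : Poly g) (hf : Poly f) : Poly (fun x => g (f x)) :=
  PT.trans hf (PT.reindex f hg)

theorem pair {f : α → β} {g : α → γ} (hf : Poly f) (hg : Poly g) : Poly (fun x => (f x, g x)) :=
  PT.cons hf hg

theorem fst {f : α → β × γ} (hf : Poly f) : Poly (fun x => (f x).1) := PT.car hf

theorem snd {f : α → β × γ} (hf : Poly f) : Poly (fun x => (f x).2) := PT.cdr hf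

theorem cons {f : α → β} {l : α → List β} (hf : Poly f) (hl : Poly l) :
    Poly (fun x => f x :: l x) :=
  PT.cons hf hl

theorem tail {l : α → List β} (hl : Poly l) : Poly (fun x => (l x).tail) :=
  (PT.cdr hl).congr (fun _ => rfl) fun x => by
    change _ = enc (l x).tail
    cases l x <;> rfl

theorem bound {f : α → β} (hf : Poly f) : ∃ P : Polynomial ℕ, ∀ x, sz (f x) ≤ P.eval (sz x) :=
  let ⟨_, P, h⟩ := hf
  ⟨P, fun x => (h x).1⟩

theorem decide_eq [EncInj β] [DecidableEq β] {f g : α → β} (hf : Poly f) (hg : Poly g) :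
    Poly (fun x => decide (f x = g x)) :=
  (PT.eq hf hg).congr (fun _ => rfl) fun x => by
    change T.ofBool _ = T.ofBool _
    simp [EncInj.inj.eq_iff]

theorem ite {p : α → Prop} [DecidablePred p] {f g : α → β} (hp : Poly (fun x => decide (p x)))
    (hf : Poly f) (hg : Poly g) : Poly (fun x => if p x then f x else g x) := by
  refine PT.cases hp ?_ ?_
  · refine (PT.reindex Subtype.val hg).congr (fun _ => rfl) ?_
    rintro ⟨x, hx⟩
    by_cases h : p x
    · simp [h, enc, T.ofBool] at hx
    · simp [h]
  · refine PT.trans (PT.cdr (PT.refl _))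
      ((PT.reindex Subtype.val hf).congr (fun _ => rfl) ?_)
    rintro ⟨x, hx⟩
    by_cases h : p x
    · simp [h]
    · simp [h, enc, T.ofBool] at hx

/-- The subtrees of a nonempty list are its head and its tail. Choosing them for every input of the
second case makes `hg` applicable by reindexing. -/
theorem list_cases {l : α → List β} {f : α → γ} {g : α → β → List β → γ} (hl : Poly l)
    (hf : Poly f) (hg : Poly (fun p : α × β × List β => g p.1 p.2.1 p.2.2)) :
    Poly (fun x => List.casesOn (motive := fun _ => γ) (l x) (f x) (fun b t => g x b t)) := by
  refine PT.cases hl ?_ ?_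
  · refine (PT.reindex Subtype.val hf).congr (fun _ => rfl) ?_
    rintro ⟨x, hx⟩
    rw [enc_list_eq_nil] at hx
    simp [hx]
  · have key : ∀ y : {x // enc (l x) ≠ .nil}, ∃ p : α × β × List β,
        p.1 = y ∧ l y = p.2.1 :: p.2.2 := by
      rintro ⟨x, hx⟩
      rw [Ne, enc_list_eq_nil] at hx
      obtain ⟨b, t, h⟩ := List.exists_cons_of_ne_nil hx
      exact ⟨(x, b, t), rfl, h⟩
    choose φ h1 h2 using key
    refine PT.trans (PT.cons (PT.cdr (PT.refl _)) (PT.car (PT.refl _)))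
      ((PT.reindex φ hg).congr (fun y => ?_) fun y => ?_)
    · change T.cons (enc (φ y).1) (enc ((φ y).2.1 :: (φ y).2.2)) = _
      rw [h1, ← h2]
      rfl
    · simp only [h2 y, h1]

theorem sum_elim {u : α → β ⊕ γ} {f : α → β → σ} {g : α → γ → σ} (hu : Poly u)
    (hf : Poly (fun p : α × β => f p.1 p.2)) (hg : Poly (fun p : α × γ => g p.1 p.2)) :
    Poly (fun x => Sum.elim (f x) (g x) (u x)) := by
  refine PT.cases (PT.car hu) ?_ ?_
  · have key : ∀ y : {x // (enc (u x)).car = .nil}, ∃ p : α × β, p.1 = y ∧ u y = .inl p.2 := by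
      rintro ⟨x, hx⟩
      cases h : u x with
      | inl b => exact ⟨(x, b), rfl, rfl⟩
      | inr c => simp [h, enc, T.car] at hx
    choose φ h1 h2 using key
    refine PT.trans (PT.cons (PT.refl _) (PT.cdr (PT.reindex Subtype.val hu)))
      ((PT.reindex φ hf).congr (fun y => ?_) fun y => ?_)
    · change T.cons (enc (φ y).1) (enc (φ y).2) = _
      rw [h1, h2]
      rfl
    · simp [h2 y, h1]
  · have key : ∀ y : {x // (enc (u x)).car ≠ .nil}, ∃ p : α × γ, p.1 = y ∧ u y = .inr p.2 := by
      rintro ⟨x, hx⟩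
      cases h : u x with
      | inl b => simp [h, enc, T.car] at hx
      | inr c => exact ⟨(x, c), rfl, rfl⟩
    choose φ h1 h2 using key
    have hcdr : PT (fun y : {x // (enc (u x)).car ≠ .nil} =>
        T.cons (enc (u y)).car (enc (y : α))) (fun y => enc (y : α)) := PT.cdr (PT.refl _)
    refine PT.trans (PT.cons hcdr (PT.cdr (hcdr.trans (PT.reindex Subtype.val hu))))
      ((PT.reindex φ hg).congr (fun y => ?_) fun y => ?_)
    · change T.cons (enc (φ y).1) (enc (φ y).2) = _
      rw [h1, h2]
      rfl
    · simp [h2 y, h1]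

/-- Folds whose intermediate results are of polynomial size. -/
theorem foldl {l : α → List β} {s : α → σ} {step : α → σ → β → σ} (hl : Poly l) (hs : Poly s)
    (hstep : Poly (fun p : α × σ × β => step p.1 p.2.1 p.2.2)) (P : Polynomial ℕ)
    (hP : ∀ x l', l' <+: l x → sz (l'.foldl (step x) (s x)) ≤ P.eval (sz x)) :
    Poly (fun x => (l x).foldl (step x) (s x)) := by
  obtain ⟨Q, hQ⟩ := hl.bound
  let φ : α × σ × List β → α × σ × List β := fun y =>
    match y.2.2 with
    | [] => y
    | b :: t => (y.1, step y.1 y.2.1 b, t)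
  have hφ : ∀ n (x : α) (z : σ) (l : List β),
      φ^[n] (x, z, l) = (x, (l.take n).foldl (step x) z, l.drop n) := by
    intro n
    induction n with
    | zero => intro x z l; simp
    | succ n ih =>
      intro x z l
      rw [iterate_succ_apply]
      cases l with
      | nil => simpa [φ] using ih x z []
      | cons b l => simpa [φ] using ih x (step x z b) l
  -- The remaining list controls the loop, while the accumulator and the parameter are carried
  -- along. Their sizes are bounded by `Q`, `P` and `.X` respectively, and the pairing adds 1.
  have main := PT.iterate (e := (enc : α → T)) (u := fun y : α × σ × List β => enc y.2.2)
    (w := fun y => T.cons (enc y.2.1) (enc y.1)) (φ := φ) (b := fun x => (x, s x, l x))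
    (N := fun x => (l x).length) (P + Q + .X + 1) ?_ ?_ ?_ ?_ ?_ ?_
  · refine (PT.car main).congr (fun _ => rfl) fun x => ?_
    simp [hφ, T.car]
  · exact PT.cons hl (PT.cons hs (PT.refl _))
  · have key : ∀ y : {y : α × σ × List β // enc y.2.2 ≠ .nil}, ∃ p : α × σ × β,
        ∃ t, y.1 = (p.1, p.2.1, p.2.2 :: t) := by
      rintro ⟨⟨x, z, l⟩, hy⟩
      rw [Ne, enc_list_eq_nil] at hy
      obtain ⟨b, t, h⟩ := List.exists_cons_of_ne_nil hy
      exact ⟨(x, z, b), t, by simp only at h; simp [h]⟩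
    choose ψ t h1 using key
    refine PT.congr (e := fun y : {y : α × σ × List β // enc y.2.2 ≠ .nil} =>
      T.cons (T.cons (enc (ψ y).2.2) (enc (t y))) (T.cons (enc (ψ y).2.1) (enc (ψ y).1)))
      (g := fun y => T.cons (enc (t y))
        (T.cons (enc (step (ψ y).1 (ψ y).2.1 (ψ y).2.2)) (enc (ψ y).1))) ?_ ?_ ?_
    · refine PT.cons (PT.cdr (PT.car (PT.refl _))) (PT.cons ?_ (PT.cdr (PT.cdr (PT.refl _))))
      refine PT.trans ?_ (PT.reindex ψ hstep)
      exact PT.cons (PT.cdr (PT.cdr (PT.refl _)))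
        (PT.cons (PT.car (PT.cdr (PT.refl _))) (PT.car (PT.car (PT.refl _))))
    · intro y; simp only [h1 y]; rfl
    · intro y; simp only [h1 y, φ]
  · intro x
    have h1 := hQ x
    have h2 := length_lt_sz (l x)
    simp only [sz] at h1 h2
    simp; omega
  · intro x n _
    rw [hφ]
    have h1 := hP x _ (List.take_prefix n (l x))
    have h2 := (sz_suffix_le (List.drop_suffix n (l x))).trans (hQ x)
    simp only [sz] at h1 h2
    simp [T.size]; omega
  · intro x n hn
    rw [hφ, Ne, enc_list_eq_nil]
    simpa using hn
  · intro x
    rw [hφ, enc_list_eq_nil]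
    simp

theorem reverse {l : α → List β} (hl : Poly l) : Poly (fun x => (l x).reverse) := by
  refine Poly.comp (g := List.reverse) ?_ hl
  have key : ∀ (l a : List β), l.foldl (fun a b => b :: a) a = l.reverse ++ a := by
    intro l
    induction l with
    | nil => simp
    | cons b l ih => simp [ih]
  refine of_eq (foldl (l := fun x : List β => x) (s := fun _ => []) (step := fun _ a b => b :: a)
    id (const _) (cons (snd (snd id)) (fst (snd id))) .X fun x l' h => ?_) fun x => by simp [key]
  simpa [key] using sz_prefix_le h

theorem append {l l' : α → List β} (hl : Poly l) (hl' : Poly l') :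
    Poly (fun x => l x ++ l' x) := by
  refine Poly.comp (g := fun p : List β × List β => p.1 ++ p.2) ?_ (pair hl hl')
  have key : ∀ (l a : List β), l.foldl (fun a b => b :: a) a = l.reverse ++ a := by
    intro l
    induction l with
    | nil => simp
    | cons b l ih => simp [ih]
  refine of_eq (foldl (l := fun x : List β × List β => x.1.reverse) (s := fun x => x.2)
    (step := fun _ a b => b :: a) (reverse (fst id)) (snd id)
    (cons (snd (snd id)) (fst (snd id))) .X fun x l' h => ?_) fun x => by simp [key]
  have h1 := sz_prefix_le h
  have h2 := sz_append l'.reverse x.2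
  obtain ⟨x, y⟩ := x
  simp [key] at *; omega

theorem map {l : α → List β} {f : α → β → γ} (hl : Poly l)
    (hf : Poly (fun p : α × β => f p.1 p.2)) : Poly (fun x => (l x).map (f x)) := by
  obtain ⟨P, hP⟩ := hl.bound
  obtain ⟨Q, hQ⟩ := hf.bound
  have key : ∀ (x : α) (l : List β) a,
      l.foldl (fun a b => f x b :: a) a = (l.map (f x)).reverse ++ a := by
    intro x l
    induction l with
    | nil => simp
    | cons b l ih => simp [ih]
  refine of_eq (reverse (foldl (l := l) (s := fun _ => []) (step := fun x a b => f x b :: a)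
    hl (const _) (cons (comp hf (pair (fst id) (snd (snd id)))) (fst (snd id)))
    -- At most `P` entries arise, each computed from a pair of size at most `1 + .X + P`.
    (1 + P * (1 + Q.comp (1 + .X + P))) fun x l' h => ?_)) fun x => by simp [key]
  rw [key, List.append_nil, sz_reverse]
  refine (sz_list_le (B := Q.eval (1 + sz x + P.eval (sz x))) ?_).trans ?_
  · intro y hy
    obtain ⟨b, hb, rfl⟩ := List.mem_map.1 hy
    refine (hQ (x, b)).trans (eval_mono Q ?_)
    have := (sz_mem (h.subset hb)).trans_le (hP x)
    simp; omega
  · have := (length_lt_sz l').le.trans ((sz_prefix_le h).trans (hP x))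
    have := Nat.mul_le_mul_right (1 + Q.eval (1 + sz x + P.eval (sz x))) this
    simpa using this

theorem flatten {l : α → List (List β)} (hl : Poly l) : Poly (fun x => (l x).flatten) := by
  refine Poly.comp (g := List.flatten) ?_ hl
  have key : ∀ (l : List (List β)) a, l.foldl (fun a b => a ++ b) a = a ++ l.flatten := by
    intro l
    induction l with
    | nil => simp
    | cons b l ih => simp [ih]
  have hsz : ∀ l : List (List β), sz l.flatten ≤ sz l := by
    intro l
    induction l with
    | nil => simp
    | cons b l ih => have := sz_append b l.flatten; simp; omega
  refine of_eq (foldl (l := fun x : List (List β) => x) (s := fun _ => [])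
    (step := fun _ a b => a ++ b) id (const _) (append (fst (snd id)) (snd (snd id))) .X
    fun x l' h => ?_) fun x => by simp [key]
  simpa [key] using (hsz l').trans (sz_prefix_le h)

theorem flatMap {l : α → List β} {f : α → β → List γ} (hl : Poly l)
    (hf : Poly (fun p : α × β => f p.1 p.2)) : Poly (fun x => (l x).flatMap (f x)) :=
  of_eq (flatten (map hl hf)) fun x => by simp [List.flatMap_def]

theorem filter {l : α → List β} {f : α → β → Bool} (hl : Poly l)
    (hf : Poly (fun p : α × β => f p.1 p.2)) : Poly (fun x => (l x).filter (f x)) := by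
  refine of_eq (flatMap (f := fun x b => if f x b = true then [b] else []) hl
    (ite (p := fun p : α × β => f p.1 p.2 = true) (of_eq hf fun x => by simp)
      (cons (snd id) (const _)) (const _))) fun x => ?_
  induction l x with
  | nil => rfl
  | cons b l ih => by_cases h : f x b = true <;> simp [h, ih]

theorem isEmpty {l : α → List β} (hl : Poly l) : Poly (fun x => (l x).isEmpty) :=
  of_eq (list_cases (g := fun _ _ _ => false) hl (const true) (const _)) fun x => by
    cases l x <;> rfl

theorem not {f : α → Bool} (hf : Poly f) : Poly (fun x => !f x) :=
  of_eq (ite (p := fun x => f x = true) (of_eq hf fun x => by simp) (const false) (const true))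
    fun x => by cases f x <;> rfl

theorem or {f g : α → Bool} (hf : Poly f) (hg : Poly g) : Poly (fun x => f x || g x) :=
  of_eq (ite (p := fun x => f x = true) (of_eq hf fun x => by simp) (const true) hg)
    fun x => by cases f x <;> rfl

theorem and {f g : α → Bool} (hf : Poly f) (hg : Poly g) : Poly (fun x => f x && g x) :=
  of_eq (ite (p := fun x => f x = true) (of_eq hf fun x => by simp) hg (const false))
    fun x => by cases f x <;> rfl

theorem decide_mem [EncInj β] {f : α → β} {l : α → List β} [∀ x, Decidable (f x ∈ l x)]
    (hf : Poly f) (hl : Poly l) : Poly (fun x => decide (f x ∈ l x)) := by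
  classical
  refine of_eq (not (isEmpty (filter (f := fun x b => decide (f x = b)) hl
    (decide_eq (comp hf (fst id)) (snd id))))) fun x => ?_
  rw [← Bool.decide_coe (!_)]
  refine decide_eq_decide.2 ?_
  simp

/-- True by definition, as numbers are written in unary. Arithmetic thereby reduces to operations on
lists. -/
theorem units {n : α → ℕ} (hn : Poly n) : Poly (fun x => List.replicate (n x) ()) := hn

theorem of_units {n : α → ℕ} (hn : Poly (fun x => List.replicate (n x) ())) : Poly n := hn

theorem length {l : α → List β} (hl : Poly l) : Poly (fun x => (l x).length) :=
  of_units (of_eq (map (f := fun _ _ => ()) hl (const _)) fun x => by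
    simp [List.map_const'])

theorem succ {n : α → ℕ} (hn : Poly n) : Poly (fun x => n x + 1) :=
  of_units (cons (const ()) (units hn))

theorem add {m n : α → ℕ} (hm : Poly m) (hn : Poly n) : Poly (fun x => m x + n x) :=
  of_units (of_eq (append (units hm) (units hn)) fun x => by simp)

theorem drop {l : α → List β} {n : α → ℕ} (hl : Poly l) (hn : Poly n) :
    Poly (fun x => (l x).drop (n x)) := by
  have key : ∀ n (l : List β), (List.replicate n ()).foldl (fun a _ => a.tail) l = l.drop n := by
    intro n
    induction n with
    | zero => simp
    | succ n ih => simp [List.replicate_succ, ih]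
  obtain ⟨P, hP⟩ := hl.bound
  refine of_eq (foldl (l := fun x => List.replicate (n x) ()) (s := l)
    (step := fun _ a _ => a.tail) (units hn) hl (tail (fst (snd id))) P fun x l' _ => ?_)
    fun x => by simp [key]
  rw [show l' = List.replicate l'.length () from List.eq_replicate_of_mem (by simp), key]
  exact (sz_suffix_le (List.drop_suffix _ _)).trans (hP x)

theorem sub {m n : α → ℕ} (hm : Poly m) (hn : Poly n) : Poly (fun x => m x - n x) :=
  of_units (of_eq (drop (units hm) hn) fun x => by simp)

theorem decide_le {m n : α → ℕ} (hm : Poly m) (hn : Poly n) :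
    Poly (fun x => decide (m x ≤ n x)) :=
  of_eq (decide_eq (sub hm hn) (const 0)) fun x => by simp [Nat.sub_eq_zero_iff_le]

theorem min {m n : α → ℕ} (hm : Poly m) (hn : Poly n) : Poly (fun x => min (m x) (n x)) :=
  of_eq (ite (decide_le hm hn) hm hn) fun x => by simp [min_def]

/-- The list is built by repeatedly shifting all entries by one and putting 0 in front, so no
counter is needed. -/
theorem range {n : α → ℕ} (hn : Poly n) : Poly (fun x => List.range (n x)) := by
  have key : ∀ n, (List.replicate n ()).foldl (fun a _ => 0 :: a.map (· + 1)) [] =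
      List.range n := by
    intro n
    induction n with
    | zero => rfl
    | succ n ih =>
      rw [List.replicate_succ', List.foldl_append, ih, List.range_succ_eq_map]
      rfl
  obtain ⟨P, hP⟩ := hn.bound
  refine of_eq (foldl (l := fun x => List.replicate (n x) ()) (s := fun _ => [])
    (step := fun _ a _ => 0 :: a.map (· + 1)) (units hn) (const _)
    (cons (const 0) (map (fst (snd id)) (succ (snd id))))
    (1 + P * (1 + (2 * P + 1))) fun x l' h => ?_) fun x => key _
  have hlen : l'.length ≤ P.eval (sz x) := by
    have h1 := h.length_le
    have h2 := hP x
    rw [sz_nat] at h2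
    simp at h1; omega
  rw [show l' = List.replicate l'.length () from List.eq_replicate_of_mem (by simp), key]
  refine (sz_list_le (B := 2 * P.eval (sz x) + 1) fun i hi => ?_).trans ?_
  · rw [List.mem_range] at hi
    rw [sz_nat]; omega
  · simpa using hlen

/-- Here `k` is a constant, so the recursion on it is unfolded into the program itself. -/
theorem take (k : ℕ) {l : α → List β} (hl : Poly l) : Poly (fun x => (l x).take k) := by
  refine Poly.comp (g := fun l : List β => l.take k) ?_ hl
  induction k with
  | zero => exact of_eq (const []) fun x => by simp
  | succ k ih =>
    exact of_eq (list_cases (g := fun _ b t => b :: t.take k) id (const [])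
      (cons (fst (snd id)) (comp ih (snd (snd id))))) fun x => by cases x <;> rfl

end Poly

/-! ## Binary addition -/

/-- The value of a string of bits, least significant bit first. -/
def bval : List Bool → ℕ
  | [] => 0
  | b :: l => b.toNat + 2 * bval l

/-- One position of a binary addition: the digits found so far, the carry, and the rest of the
second summand. -/
def addStep (z : (List Bool × Bool) × List Bool) (b : Bool) : (List Bool × Bool) × List Bool :=
  ((decide (decide (b = z.2.headD false) = z.1.2) :: z.1.1,
    b && z.2.headD false || (z.1.2 && (b || z.2.headD false))), z.2.tail)

/-- Binary addition. -/
def addBits (x y : List Bool) : List Bool :=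
  let z := (x ++ (y.drop x.length).map fun _ => false).foldl addStep (([], false), y)
  (z.1.2 :: z.1.1).reverse

/-- The sum of a list of binary numbers. -/
def sumBits (l : List (List Bool)) : List Bool := l.foldl addBits []

/-- Remove leading zeros. -/
def strip (l : List Bool) : List Bool :=
  l.reverse.foldl (fun a b => if a.isEmpty && !b then [] else b :: a) []

theorem bval_append (l l' : List Bool) : bval (l ++ l') = bval l + 2 ^ l.length * bval l' := by
  induction l with
  | nil => simp [bval]
  | cons b l ih => simp [bval, ih, pow_succ]; ring

/-- The new digit is the exclusive or and the new carry the majority of the three bits, so each step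
preserves the total value. The length condition ensures that `y` is used up; `addBits` pads `x` with
zeros for this reason. -/
theorem foldl_addStep (l : List Bool) : ∀ (out : List Bool) (c : Bool) (y : List Bool),
    y.length ≤ l.length →
    bval ((l.foldl addStep ((out, c), y)).1.2 :: (l.foldl addStep ((out, c), y)).1.1).reverse =
      bval out.reverse + 2 ^ out.length * (c.toNat + bval y + bval l) ∧
    (l.foldl addStep ((out, c), y)).1.1.length = out.length + l.length := by
  induction l with
  | nil =>
    intro out c y hy
    obtain rfl : y = [] := by simpa using hy
    simp [bval_append, bval]
  | cons b l ih =>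
    intro out c y hy
    rw [List.foldl_cons, addStep]
    obtain ⟨h1, h2⟩ := ih (decide (decide (b = y.headD false) = c) :: out)
      (b && y.headD false || (c && (b || y.headD false))) y.tail (by simp at hy ⊢; omega)
    refine ⟨h1.trans ?_, h2.trans (by simp; omega)⟩
    cases y with
    | nil =>
      cases b <;> cases c <;> simp [bval_append, bval, pow_succ] <;> ring
    | cons d y =>
      cases b <;> cases c <;> cases d <;> simp [bval_append, bval, pow_succ] <;> ring

theorem bval_replicate_false (n : ℕ) : bval (List.replicate n false) = 0 := by
  induction n with
  | zero => rfl
  | succ n ih => simp [List.replicate_succ, bval, ih]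

theorem bval_addBits (x y : List Bool) : bval (addBits x y) = bval x + bval y := by
  have := (foldl_addStep (x ++ (y.drop x.length).map fun _ => false) [] false y
    (by simp; omega)).1
  refine this.trans ?_
  simp [bval, bval_append, List.map_const', bval_replicate_false]
  omega

theorem length_addBits (x y : List Bool) :
    (addBits x y).length ≤ max x.length y.length + 1 := by
  have := (foldl_addStep (x ++ (y.drop x.length).map fun _ => false) [] false y
    (by simp; omega)).2
  simp only [addBits, List.length_reverse, List.length_cons, this]
  simp; omega

theorem bval_sumBits (l : List (List Bool)) : bval (sumBits l) = (l.map bval).sum := by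
  have : ∀ (l : List (List Bool)) a, bval (l.foldl addBits a) = bval a + (l.map bval).sum := by
    intro l
    induction l with
    | nil => simp
    | cons b l ih => intro a; simp [ih, bval_addBits]; omega
  exact (this l []).trans (by simp [bval])

/-- One addition lengthens the maximum by at most one bit, so the induction raises `L` by one. The
estimate is crude, but additive in the number of summands. -/
theorem length_foldl_addBits (L : ℕ) : ∀ (l : List (List Bool)) a, a.length ≤ L →
    (∀ x ∈ l, x.length ≤ L) → (l.foldl addBits a).length ≤ L + l.length := by
  intro l
  induction l generalizing L with
  | nil => intro a ha _; simpa using ha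
  | cons b l ih =>
    intro a ha h
    have h1 := length_addBits a b
    have h2 := h b (by simp)
    have := ih (L + 1) (addBits a b) (by omega) fun x hx => (h x (by simp [hx])).trans (by omega)
    simp; omega

theorem sz_bits (l : List Bool) : sz l ≤ 1 + 4 * l.length := by
  have := sz_list_le (l := l) (B := 3) fun x _ => sz_bool x
  omega

theorem encodeNat_bit0 {n : ℕ} (hn : n ≠ 0) : encodeNat (2 * n) = false :: encodeNat n := by
  unfold encodeNat
  have : ((2 * n : ℕ) : Num) = Num.bit0 (n : Num) := by
    rw [← Num.ofNat'_eq, ← Num.ofNat'_eq]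
    simpa [Nat.bit] using Num.ofNat'_bit false n
  rw [this]
  cases h : (n : Num) with
  | zero =>
    have h1 : ((n : Num) : ℕ) = 0 := by rw [h]; rfl
    simp at h1; omega
  | pos m => rfl

theorem encodeNat_bit1 (n : ℕ) : encodeNat (2 * n + 1) = true :: encodeNat n := by
  unfold encodeNat
  have : ((2 * n + 1 : ℕ) : Num) = Num.bit1 (n : Num) := by
    rw [← Num.ofNat'_eq, ← Num.ofNat'_eq]
    simpa [Nat.bit] using Num.ofNat'_bit true n
  rw [this]
  cases h : (n : Num) with
  | zero => rfl
  | pos m => rfl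

/-- The output has to be the canonical string `encodeNat`, whereas the adder leaves superfluous
zeros at the significant end. -/
theorem strip_eq (l : List Bool) : strip l = encodeNat (bval l) := by
  unfold strip
  rw [List.foldl_reverse]
  induction l with
  | nil => rfl
  | cons b l ih =>
    have h0 : ∀ n, (encodeNat n).isEmpty = true ↔ n = 0 := by
      intro n
      constructor
      · intro h
        rw [← Computability.decode_encodeNat n, List.isEmpty_iff.1 h]
        rfl
      · rintro rfl; rfl
    rw [List.foldr_cons, ih]
    by_cases hz : bval l = 0
    · cases b <;> simp [bval, hz]
      · rfl
      · exact (encodeNat_bit1 0).symm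
    · have h1 : (encodeNat (bval l)).isEmpty = false := by
        rw [Bool.eq_false_iff, Ne, h0]; exact hz
      cases b
      · simp [h1, bval, encodeNat_bit0 hz]
      · simp [bval, add_comm 1, encodeNat_bit1]

theorem bval_encodeNat (n : ℕ) : bval (encodeNat n) = n := by
  induction n using Nat.strong_induction_on with
  | _ n ih =>
    rcases Nat.even_or_odd' n with ⟨m, rfl | rfl⟩
    · by_cases hm : m = 0
      · subst hm; rfl
      · rw [encodeNat_bit0 hm, bval, ih m (by omega)]; simp
    · rw [encodeNat_bit1, bval, ih m (by omega)]; simp; omega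

/-! ### Binary addition in polynomial time -/

namespace Poly
variable {α β : Type} [Enc α] [Enc β]

theorem headD {l : α → List β} {d : β} (hl : Poly l) : Poly (fun x => (l x).headD d) :=
  of_eq (list_cases (g := fun _ b _ => b) hl (const d) (fst (snd id))) fun x => by
    cases l x <;> rfl

theorem addBits {f g : α → List Bool} (hf : Poly f) (hg : Poly g) :
    Poly (fun x => addBits (f x) (g x)) := by
  refine comp (g := fun p : List Bool × List Bool => SPControl.addBits p.1 p.2) ?_ (pair hf hg)
  have main : Poly (fun p : List Bool × List Bool =>
      (p.1 ++ (p.2.drop p.1.length).map fun _ => false).foldl addStep (([], false), p.2)) := by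
    have hz : Poly (fun q : (List Bool × List Bool) × ((List Bool × Bool) × List Bool) × Bool =>
        q.2.1.2.headD false) := headD (snd (fst (snd id)))
    have hb : Poly (fun q : (List Bool × List Bool) × ((List Bool × Bool) × List Bool) × Bool =>
        q.2.2) := snd (snd id)
    have hc : Poly (fun q : (List Bool × List Bool) × ((List Bool × Bool) × List Bool) × Bool =>
        q.2.1.1.2) := snd (fst (fst (snd id)))
    refine foldl (step := fun _ => addStep)
      (append (fst id) (map (f := fun _ _ => false) (drop (snd id) (length (fst id))) (const _)))
      (pair (const _) (snd id))
      (pair (pair (cons (decide_eq (decide_eq hb hz) hc) (fst (fst (fst (snd id)))))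
        (or (and hb hz) (and hc (or hb hz)))) (tail (snd (fst (snd id)))))
      (6 + 8 * .X) fun p l' h => ?_
    have key : ∀ (l : List Bool) z, sz (l.foldl addStep z).1.1 ≤ sz z.1.1 + 4 * l.length ∧
        sz (l.foldl addStep z).2 ≤ sz z.2 := by
      intro l
      induction l with
      | nil => simp
      | cons b l ih =>
        intro z
        have h1 := ih (addStep z b)
        have h2 := sz_bool (decide (decide (b = z.2.headD false) = z.1.2))
        have h3 := sz_suffix_le (List.tail_suffix z.2)
        rw [addStep] at h1
        rw [List.foldl_cons, addStep]
        simp only [sz_cons, List.length_cons] at h1 ⊢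
        omega
    have h1 := key l' (([], false), p.2)
    have h2 := h.length_le
    have h3 := length_lt_sz p.1
    have h4 := length_lt_sz p.2
    have h5 := sz_bool (l'.foldl addStep (([], false), p.2)).1.2
    obtain ⟨x, y⟩ := p
    rw [show ∀ z : (List Bool × Bool) × List Bool, sz z = 1 + (1 + sz z.1.1 + sz z.1.2) + sz z.2
      from fun _ => rfl]
    simp at h1 h2 h3 h4 h5 ⊢
    omega
  exact reverse (cons (snd (fst main)) (fst (fst main)))

theorem sumBits {l : α → List (List Bool)} (hl : Poly l) : Poly (fun x => sumBits (l x)) := by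
  refine comp (g := SPControl.sumBits) ?_ hl
  refine foldl (l := fun x : List (List Bool) => x) (s := fun _ => [])
    (step := fun _ => SPControl.addBits) id (const _)
    (addBits (fst (snd id)) (snd (snd id))) (1 + 4 * (.X + .X)) fun x l' h => ?_
  refine (sz_bits _).trans ?_
  have h1 := length_foldl_addBits (sz x) l' [] (by simp) fun y hy =>
    ((length_lt_sz y).trans (sz_mem (h.subset hy))).le
  have h2 := h.length_le
  have h3 := length_lt_sz x
  simp; omega

theorem strip {l : α → List Bool} (hl : Poly l) : Poly (fun x => strip (l x)) := by
  refine comp (g := SPControl.strip) ?_ hl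
  refine foldl (l := fun x : List Bool => x.reverse) (s := fun _ => [])
    (step := fun _ a b => if a.isEmpty && !b then [] else b :: a) (reverse id) (const _)
    (ite (of_eq (and (isEmpty (fst (snd id))) (not (snd (snd id)))) fun x => by
      cases x.2.1 <;> simp)
      (const _) (cons (snd (snd id)) (fst (snd id)))) .X fun x l' h => ?_
  have key : ∀ (l a : List Bool),
      sz (l.foldl (fun a b => if a.isEmpty && !b then [] else b :: a) a) + 1 ≤ sz l + sz a := by
    intro l
    induction l with
    | nil => intro a; simp [add_comm]
    | cons b l ih =>
      intro a
      rw [List.foldl_cons]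
      refine (ih _).trans ?_
      split_ifs
      · have := sz_pos a; simp; omega
      · simp; omega
  have h1 := key l' []
  have h2 := sz_prefix_le h
  simp at h1 h2 ⊢
  omega

end Poly

/-! ## The dynamic program -/

/-- The possible decisions about a voter: does the decision count against the bound, and does the
voter take part in the election? -/
abbrev Opts : Type := List (Bool × Bool)

/-- The events of the sweep along the axis: the sweep leaves a candidate, which may be the
designated one, or the sweep meets a voter, whose leftmost approved candidate is the current one. -/
abbrev Ev : Type := Bool ⊕ Opts

/-- The states of the sweep: the presumed score of the designated candidate, whether some other
candidate that was left has at least this score, the number of decisions that count against the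
bound, and the scores of the current candidate and its successors. -/
abbrev State : Type := ℕ × Bool × ℕ × List ℕ

/-- Leaving a candidate. -/
def leave (isP : Bool) (q : State) : List State :=
  List.casesOn (motive := fun _ => List State) q.2.2.2 [] fun x w =>
    if isP = true then if x = q.1 then [(q.1, q.2.1, q.2.2.1, w ++ [0])] else []
    else [(q.1, q.2.1 || decide (q.1 ≤ x), q.2.2.1, w ++ [0])]

/-- Carrying out a decision about a voter. -/
def decideVoter (q : State) (o : Bool × Bool) : State :=
  (q.1, q.2.1, if o.1 = true then q.2.2.1 + 1 else q.2.2.1,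
    if o.2 = true then q.2.2.2.map (· + 1) else q.2.2.2)

/-- The possible successors of a state. -/
def succStates (e : Ev) (q : State) : List State :=
  Sum.elim (fun isP => leave isP q) (fun opts => opts.map (decideVoter q)) e

/-- All lists of length `k` of numbers up to `N`. -/
def windows : ℕ → ℕ → List (List ℕ)
  | 0, _ => [[]]
  | k + 1, N => (windows k N).flatMap fun w => (List.range (N + 1)).map fun x => x :: w

/-- All states with numbers up to `N`. -/
def states (k N : ℕ) : List State :=
  (List.range (N + 1)).flatMap fun s => [false, true].flatMap fun fl =>
    (List.range (N + 1)).flatMap fun t => (windows k N).map fun w => (s, fl, t, w)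

/-- A table gives the number of ways to reach a state. -/
abbrev Table : Type := List (State × List Bool)

/-- The total number of ways to reach the state `q` in a table. -/
def totalAt (tab : Table) (q : State) : List Bool :=
  sumBits ((tab.filter fun r => decide (r.1 = q)).map Prod.snd)

/-- The table after an event. -/
def updateTable (Q : List State) (tab : Table) (e : Ev) : Table :=
  Q.map fun q => (q, totalAt (tab.flatMap fun r => (succStates e r.1).map fun q' => (q', r.2)) q)

/-- The table at the beginning. -/
def initTable (k N : ℕ) : Table :=
  (List.range (N + 1)).map fun s => ((s, false, 0, List.replicate k 0), [true])

/-- The number of ways to reach a final state. -/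
def accepted (target : Bool) (bound : ℕ) (tab : Table) : List Bool :=
  strip (sumBits ((tab.filter fun r =>
    decide (r.1.2.2.1 ≤ bound) && decide (r.1.2.1 = target)).map Prod.snd))

/-- Voters are given by their approved candidates and the event of meeting them. -/
abbrev Voter : Type := List (List Bool) × Ev

/-- Meet the voters that approve `a`, and leave `a`. -/
def sweepStep (p : List Bool) (z : List Voter × List Ev) (a : List Bool) :
    List Voter × List Ev :=
  (z.1.filter fun v => !decide (a ∈ v.1),
    z.2 ++ ((z.1.filter fun v => decide (a ∈ v.1)).map Prod.snd ++ [Sum.inl (decide (a = p))]))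

/-- The events of the sweep. -/
def sweepEvents (p : List Bool) (axis : List (List Bool)) (voters : List Voter) : List Ev :=
  (axis.foldl (sweepStep p) (voters, [])).2

/-- The minimum of `N` and the number with the given bits. -/
def capped (bits : List Bool) (N : ℕ) : ℕ :=
  bits.reverse.foldl (fun u b => min (u + u + if b = true then 1 else 0) N) 0

/-- The number of admissible choices. -/
def solve (k : ℕ) (target : Bool) (axis : List (List Bool)) (voters : List Voter)
    (p bound : List Bool) : List Bool :=
  let evs := sweepEvents p axis voters
  let N := evs.length + voters.length
  accepted target (capped bound N) (evs.foldl (updateTable (states k N)) (initTable k N))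

/-- A voter moves at most once from the waiting list to the events, losing the approved candidates
on the way. Each candidate adds one event of constant size, for which 10 is a generous allowance. -/
theorem sz_foldl_sweepStep (p : List Bool) (l : List (List Bool)) :
    ∀ z : List Voter × List Ev,
      sz (l.foldl (sweepStep p) z).1 + sz (l.foldl (sweepStep p) z).2 ≤
        sz z.1 + sz z.2 + 10 * l.length := by
  have hf : ∀ (p : Voter → Bool) (l : List Voter),
      sz (l.filter fun v => !p v) + sz ((l.filter p).map Prod.snd) ≤ 1 + sz l := by
    intro p l
    induction l with
    | nil => simp
    | cons v l ih =>
      have h1 : sz v = 1 + sz v.1 + sz v.2 := rfl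
      cases hv : p v <;> simp [hv] <;> omega
  induction l with
  | nil => simp
  | cons a l ih =>
    intro z
    refine (ih _).trans ?_
    have h1 := hf (fun v => decide (a ∈ v.1)) z.1
    have h2 := sz_append z.2 ((z.1.filter fun v => decide (a ∈ v.1)).map Prod.snd ++
      [Sum.inl (decide (a = p))])
    have h3 := sz_append ((z.1.filter fun v => decide (a ∈ v.1)).map Prod.snd)
      [(Sum.inl (decide (a = p)) : Ev)]
    have h4 := sz_bool (decide (a = p))
    have h5 : ∀ b : Bool, sz (Sum.inl b : Ev) = 2 + sz b := fun _ => rfl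
    simp only [sweepStep, List.length_cons]
    simp only [sz_cons, sz_nil, h5] at h2 h3
    omega

/-! ### The dynamic program in polynomial time -/

namespace Poly
variable {α β : Type} [Enc α] [Enc β]

theorem inl {γ : Type} [Enc γ] {f : α → β} (hf : Poly f) :
    Poly (fun x => (Sum.inl (f x) : β ⊕ γ)) :=
  PT.cons PT.nil hf

theorem coe {f : α → Bool} (hf : Poly f) : Poly (fun x => decide (f x = true)) :=
  of_eq hf fun x => by simp

theorem leave {isP : α → Bool} {q : α → State} (hP : Poly isP) (hq : Poly q) :
    Poly (fun x => leave (isP x) (q x)) := by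
  refine comp (g := fun x : State × Bool => SPControl.leave x.2 x.1) ?_ (pair hq hP)
  unfold SPControl.leave
  refine list_cases (snd (snd (snd (fst id)))) (const _) ?_
  have s : Poly (fun y : (State × Bool) × ℕ × List ℕ => y.1.1.1) := fst (fst (fst id))
  have fl : Poly (fun y : (State × Bool) × ℕ × List ℕ => y.1.1.2.1) := fst (snd (fst (fst id)))
  have t : Poly (fun y : (State × Bool) × ℕ × List ℕ => y.1.1.2.2.1) :=
    fst (snd (snd (fst (fst id))))
  have w : Poly (fun y : (State × Bool) × ℕ × List ℕ => y.2.2 ++ [0]) :=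
    append (snd (snd id)) (const _)
  have x : Poly (fun y : (State × Bool) × ℕ × List ℕ => y.2.1) := fst (snd id)
  exact ite (coe (snd (fst id)))
    (ite (decide_eq x s) (cons (pair s (pair fl (pair t w))) (const _)) (const _))
    (cons (pair s (pair (or fl (decide_le s x)) (pair t w))) (const _))

theorem decideVoter {q : α → State} {o : α → Bool × Bool} (hq : Poly q) (ho : Poly o) :
    Poly (fun x => decideVoter (q x) (o x)) :=
  pair (fst hq) (pair (fst (snd hq))
    (pair (ite (coe (fst ho)) (succ (fst (snd (snd hq)))) (fst (snd (snd hq))))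
      (ite (coe (snd ho)) (map (snd (snd (snd hq))) (succ (snd id)))
        (snd (snd (snd hq))))))

theorem succStates {e : α → Ev} {q : α → State} (he : Poly e) (hq : Poly q) :
    Poly (fun x => succStates (e x) (q x)) :=
  sum_elim (f := fun x b => SPControl.leave b (q x))
    (g := fun x (o : Opts) => List.map (SPControl.decideVoter (q x)) o) he
    (leave (snd id) (comp hq (fst id)))
    (map (f := fun x => SPControl.decideVoter (q x.1)) (snd id)
      (decideVoter (comp hq (fst (fst id))) (snd id)))

/-- This is where `k` has to be fixed: the list has `(n + 1) ^ k` entries, and the program is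
assembled by recursion on `k`. -/
theorem windows (k : ℕ) {n : α → ℕ} (hn : Poly n) : Poly (fun x => windows k (n x)) := by
  induction k with
  | zero => exact const _
  | succ k ih =>
    exact flatMap ih (map (range (succ (comp hn (fst id)))) (cons (snd id) (snd (fst id))))

theorem states (k : ℕ) {n : α → ℕ} (hn : Poly n) : Poly (fun x => states k (n x)) :=
  comp (g := fun N => SPControl.states k N)
    (flatMap (range (succ id)) (flatMap (const _) (flatMap (range (succ (fst (fst id))))
      (map (windows k (fst (fst (fst id))))
        (pair (snd (fst (fst (fst id)))) (pair (snd (fst (fst id)))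
          (pair (snd (fst id)) (snd id)))))))) hn

theorem totalAt {tab : α → Table} {q : α → State} (ht : Poly tab) (hq : Poly q) :
    Poly (fun x => totalAt (tab x) (q x)) :=
  sumBits (map (filter (f := fun x r => decide (r.1 = q x)) ht
    (decide_eq (fst (snd id)) (comp hq (fst id)))) (snd (snd id)))

theorem updateTable {Q : α → List State} {tab : α → Table} {e : α → Ev} (hQ : Poly Q)
    (ht : Poly tab) (he : Poly e) : Poly (fun x => updateTable (Q x) (tab x) (e x)) := by
  have h : Poly (fun y : α × State => (tab y.1).flatMap fun r =>
      (SPControl.succStates (e y.1) r.1).map fun q' => (q', r.2)) :=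
    flatMap (f := fun y r => (SPControl.succStates (e y.1) r.1).map fun q' => (q', r.2))
      (comp ht (fst id)) (map (f := fun y q' => (q', y.2.2))
        (succStates (comp he (fst (fst id))) (fst (snd id))) (pair (snd id) (snd (snd (fst id)))))
  exact map (f := fun x q => (q, SPControl.totalAt ((tab x).flatMap fun r =>
    (SPControl.succStates (e x) r.1).map fun q' => (q', r.2)) q)) hQ
    (pair (snd id) (totalAt h (snd id)))

theorem initTable (k : ℕ) {n : α → ℕ} (hn : Poly n) : Poly (fun x => initTable k (n x)) :=
  comp (g := fun N => SPControl.initTable k N)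
    (map (range (succ id)) (pair (pair (snd id) (const _)) (const _))) hn

theorem accepted (target : Bool) {n : α → ℕ} {tab : α → Table} (hn : Poly n) (ht : Poly tab) :
    Poly (fun x => accepted target (n x) (tab x)) :=
  strip (sumBits (map (filter (f := fun x r =>
      decide (r.1.2.2.1 ≤ n x) && decide (r.1.2.1 = target)) ht (and
    (decide_le (fst (snd (snd (fst (snd id))))) (comp hn (fst id)))
    (decide_eq (fst (snd (fst (snd id)))) (const target)))) (snd (snd id))))

theorem sweepStep {p : α → List Bool} {z : α → List Voter × List Ev} {a : α → List Bool}
    (hp : Poly p) (hz : Poly z) (ha : Poly a) : Poly (fun x => sweepStep (p x) (z x) (a x)) := by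
  have hmem : Poly (fun y : α × Voter => decide (a y.1 ∈ y.2.1)) :=
    decide_mem (comp ha (fst id)) (fst (snd id))
  exact pair (filter (f := fun x v => !decide (a x ∈ v.1)) (fst hz) (not hmem))
    (append (snd hz) (append
      (map (filter (f := fun x v => decide (a x ∈ v.1)) (fst hz) hmem) (snd (snd id)))
      (cons (inl (decide_eq ha hp)) (const _))))

theorem sweepEvents {p : α → List Bool} {axis : α → List (List Bool)} {voters : α → List Voter}
    (hp : Poly p) (ha : Poly axis) (hv : Poly voters) :
    Poly (fun x => sweepEvents (p x) (axis x) (voters x)) := by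
  refine comp (g := fun x : List Bool × List (List Bool) × List Voter =>
    SPControl.sweepEvents x.1 x.2.1 x.2.2) ?_ (pair hp (pair ha hv))
  suffices main : Poly (fun x : List Bool × List (List Bool) × List Voter =>
      x.2.1.foldl (SPControl.sweepStep x.1) (x.2.2, [])) from snd main
  have hs : Poly (fun x : List Bool × List (List Bool) × List Voter =>
      (x.2.2, ([] : List Ev))) := pair (snd (snd id)) (const _)
  have hstep : Poly (fun y : (List Bool × List (List Bool) × List Voter) ×
      (List Voter × List Ev) × List Bool => SPControl.sweepStep y.1.1 y.2.1 y.2.2) :=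
    sweepStep (fst (fst id)) (fst (snd id)) (snd (snd id))
  have hl : Poly (fun x : List Bool × List (List Bool) × List Voter => x.2.1) := fst (snd id)
  refine foldl (step := fun x : List Bool × List (List Bool) × List Voter =>
    SPControl.sweepStep x.1) hl hs hstep (10 + 10 * .X) fun x l' h => ?_
  have h1 := sz_foldl_sweepStep x.1 l' (x.2.2, [])
  have h2 := h.length_le
  have h3 := length_lt_sz x.2.1
  obtain ⟨p, axis, voters⟩ := x
  rw [show ∀ z : List Voter × List Ev, sz z = 1 + sz z.1 + sz z.2 from fun _ => rfl]
  simp at h1 h2 h3 ⊢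
  omega

/-- Converting the bound from binary to unary could blow it up exponentially. Cutting off at `n`
after every doubling keeps the intermediate values small. -/
theorem capped {l : α → List Bool} {n : α → ℕ} (hl : Poly l) (hn : Poly n) :
    Poly (fun x => capped (l x) (n x)) := by
  refine comp (g := fun x : List Bool × ℕ => SPControl.capped x.1 x.2) ?_ (pair hl hn)
  refine foldl (step := fun x u b => Min.min (u + u + if b = true then 1 else 0) x.2)
    (reverse (fst id)) (const 0) (min (add (add (fst (snd id)) (fst (snd id)))
      (ite (coe (snd (snd id))) (const _) (const _))) (snd (fst id))) .X fun x l' _ => ?_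
  have key : l'.foldl (fun u b => Min.min (u + u + if b = true then 1 else 0) x.2) 0 ≤ x.2 := by
    induction l' using List.reverseRecOn with
    | nil => simp
    | append_singleton l b _ => simp
  obtain ⟨x, N⟩ := x
  simp [sz_nat] at *
  omega

/-- Let `n` be the size of the whole input. A table has at most `n` rows with at most `n` successors
each, so an event adds at most `n * n` binary numbers and lengthens the entries by at most that many
bits. Over at most `n` events the entries stay below `n + n * (n * n)` bits. -/
theorem run {Q : α → List State} {tab : α → Table} {evs : α → List Ev} (hQ : Poly Q)
    (ht : Poly tab) (he : Poly evs) :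
    Poly (fun x => (evs x).foldl (SPControl.updateTable (Q x)) (tab x)) := by
  refine comp (g := fun x : List State × Table × List Ev =>
    x.2.2.foldl (SPControl.updateTable x.1) x.2.1) ?_ (pair hQ (pair ht he))
  refine foldl (step := fun x => SPControl.updateTable x.1) (snd (snd id)) (fst (snd id))
    (updateTable (fst (fst id)) (fst (snd id)) (snd (snd id)))
    (1 + .X * (1 + (1 + .X + (1 + 4 * (.X + .X * (.X * .X)))))) fun x l' h => ?_
  have hlen : ∀ (e : Ev) (q : State), (SPControl.succStates e q).length ≤ sz e := by
    rintro (b | o) q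
    · refine le_trans ?_ (sz_pos (Sum.inl b : Ev))
      rcases q with ⟨s, fl, t, _ | ⟨y, w⟩⟩
      · simp [SPControl.succStates, SPControl.leave]
      · simp only [SPControl.succStates, SPControl.leave, Sum.elim_inl]
        split_ifs <;> simp
    · have h1 := length_lt_sz o
      have h2 : sz (Sum.inr o : Ev) = 4 + sz o := by
        simp [sz, enc, T.size]
      simp [SPControl.succStates]; omega
  have key : ∀ (n : ℕ) (l : List Ev), (∀ e ∈ l, sz e ≤ n) → ∀ (L : ℕ) (tab : Table),
      x.1.length ≤ n → (∀ q ∈ x.1, sz q ≤ n) →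
      tab.length ≤ n → (∀ r ∈ tab, sz r.1 ≤ n ∧ r.2.length ≤ L) →
      (l.foldl (SPControl.updateTable x.1) tab).length ≤ n ∧
      ∀ r ∈ l.foldl (SPControl.updateTable x.1) tab,
        sz r.1 ≤ n ∧ r.2.length ≤ L + l.length * (n * n) := by
    intro n l
    induction l with
    | nil => intro _ L tab _ _ h1 h2; exact ⟨h1, by simpa using h2⟩
    | cons e l ih =>
      intro he L tab hQ hq ht hr
      have := ih (fun e he' => he e (by simp [he'])) (L + n * n)
        (SPControl.updateTable x.1 tab e) hQ hq (by simpa [SPControl.updateTable] using hQ) ?_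
      · refine ⟨this.1, fun r hr' => ⟨(this.2 r hr').1, (this.2 r hr').2.trans ?_⟩⟩
        simp only [List.length_cons, Nat.succ_mul]
        omega
      · intro r hr'
        obtain ⟨q, hq', rfl⟩ := List.mem_map.1 hr'
        refine ⟨hq q hq', ?_⟩
        refine (length_foldl_addBits L _ _ (by simp) ?_).trans ?_
        · intro y hy
          simp only [List.mem_map, List.mem_filter, List.mem_flatMap] at hy
          obtain ⟨_, ⟨⟨r, hr1, q', _, rfl⟩, _⟩, rfl⟩ := hy
          exact (hr r hr1).2
        · refine Nat.add_le_add_left ?_ L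
          rw [List.length_map]
          refine (List.length_filter_le _ _).trans ?_
          rw [List.length_flatMap]
          refine (List.sum_le_card_nsmul _ n ?_).trans ?_
          · intro y hy
            obtain ⟨r, _, rfl⟩ := List.mem_map.1 hy
            rw [List.length_map]
            exact (hlen e r.1).trans (he e (by simp))
          · simpa using Nat.mul_le_mul_right n ht
  obtain ⟨Q, tab, evs⟩ := x
  have hn : sz (Q, tab, evs) = 1 + sz Q + (1 + sz tab + sz evs) := rfl
  set n := sz (Q, tab, evs) with hn'
  have := key n l' ?_ n tab ?_ ?_ ?_ ?_
  · refine (sz_list_le (B := 1 + n + (1 + 4 * (n + n * (n * n)))) ?_).trans ?_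
    · intro r hr
      have h1 := this.2 r hr
      have h2 : sz r = 1 + sz r.1 + sz r.2 := rfl
      have h3 := sz_bits r.2
      have h4 : l'.length * (n * n) ≤ n * (n * n) :=
        Nat.mul_le_mul_right _ (h.length_le.trans ((length_lt_sz evs).le.trans (by omega)))
      omega
    · simpa using this.1
  · intro e he
    have := sz_mem (h.subset he)
    simp only at this
    omega
  · have := length_lt_sz Q
    simp only; omega
  · intro q hq
    have := sz_mem hq
    simp only at this
    omega
  · have := length_lt_sz tab
    omega
  · intro r hr
    have h1 := sz_mem hr
    have h2 : sz r = 1 + sz r.1 + sz r.2 := rfl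
    have h3 := length_lt_sz r.2
    omega

theorem solve (k : ℕ) (target : Bool) {axis : α → List (List Bool)} {voters : α → List Voter}
    {p bound : α → List Bool} (ha : Poly axis) (hv : Poly voters) (hp : Poly p)
    (hb : Poly bound) : Poly (fun x => solve k target (axis x) (voters x) (p x) (bound x)) := by
  have hE := sweepEvents hp ha hv
  have hN := add (length hE) (length hv)
  exact accepted target (capped hb hN) (run (states k hN) (initTable k hN) hE)

end Poly

/-! ## Correctness of the tables -/

/-- The number of ways in which the sweep ends well. -/
def cnt (target : Bool) (bound : ℕ) : List Ev → State → ℕ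
  | [], q => if q.2.2.1 ≤ bound ∧ q.2.1 = target then 1 else 0
  | e :: evs, q => ((succStates e q).map (cnt target bound evs)).sum

/-- The sum of the values of `f` on the states, weighted by a table. -/
def tval (f : State → ℕ) (tab : Table) : ℕ := (tab.map fun r => bval r.2 * f r.1).sum

/-! ### The list of states -/

theorem mem_windows {k N : ℕ} {w : List ℕ} :
    w ∈ windows k N ↔ w.length = k ∧ ∀ x ∈ w, x ≤ N := by
  induction k generalizing w with
  | zero => cases w <;> simp [windows]
  | succ k ih =>
    simp only [windows, List.mem_flatMap, List.mem_map, List.mem_range, ih]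
    constructor
    · rintro ⟨w, ⟨rfl, h⟩, x, hx, rfl⟩
      simp only [List.length_cons, List.mem_cons, forall_eq_or_imp, true_and]
      exact ⟨by omega, h⟩
    · rintro ⟨h1, h2⟩
      cases w with
      | nil => simp at h1
      | cons x w =>
        simp only [List.length_cons, List.mem_cons, forall_eq_or_imp] at h1 h2
        exact ⟨w, ⟨by omega, h2.2⟩, x, by omega, rfl⟩

theorem mem_states {k N : ℕ} {q : State} :
    q ∈ states k N ↔ q.1 ≤ N ∧ q.2.2.1 ≤ N ∧ q.2.2.2.length = k ∧ ∀ x ∈ q.2.2.2, x ≤ N := by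
  obtain ⟨s, fl, t, w⟩ := q
  simp only [states, List.mem_flatMap, List.mem_map, List.mem_range, mem_windows, Prod.mk.injEq]
  constructor
  · rintro ⟨s', hs, fl', -, t', ht, w', hw, rfl, rfl, rfl, rfl⟩
    exact ⟨by omega, by omega, hw⟩
  · rintro ⟨hs, ht, hw⟩
    exact ⟨s, by omega, fl, by cases fl <;> simp, t, by omega, w, hw, rfl, rfl, rfl, rfl⟩

/-- The map `g` recovers the block from which an element comes, so different blocks are disjoint. -/
theorem nodup_flatMap_of_retract {α β : Type} {l : List α} {f : α → List β} (g : β → α)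
    (hl : l.Nodup) (hf : ∀ x ∈ l, (f x).Nodup) (hg : ∀ x, ∀ y ∈ f x, g y = x) :
    (l.flatMap f).Nodup := by
  refine List.nodup_flatMap.2 ⟨hf, hl.imp fun {x y} hxy => ?_⟩
  intro z hz hz'
  exact hxy ((hg x z hz).symm.trans (hg y z hz'))

theorem nodup_windows (k N : ℕ) : (windows k N).Nodup := by
  induction k with
  | zero => simp [windows]
  | succ k ih =>
    refine nodup_flatMap_of_retract List.tail ih (fun w _ => ?_) fun w y hy => ?_
    · exact List.nodup_range.map fun x y h => (List.cons.inj h).1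
    · obtain ⟨x, _, rfl⟩ := List.mem_map.1 hy
      rfl

/-- A repeated state would receive its total in several rows and be counted several times. -/
theorem nodup_states (k N : ℕ) : (states k N).Nodup := by
  refine nodup_flatMap_of_retract (fun q => q.1) List.nodup_range (fun s _ =>
    nodup_flatMap_of_retract (fun q => q.2.1) (by simp) (fun fl _ =>
      nodup_flatMap_of_retract (fun q => q.2.2.1) List.nodup_range (fun t _ =>
        (nodup_windows k N).map fun w w' h => by simpa using h) ?_) ?_) ?_
  all_goals intro x y hy; simp at hy; aesop

/-- Merging rows with equal state keeps the weighted sum. Rows whose state is not in `Q` get lost,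
which does no harm if their value is zero. -/
theorem sum_totalAt (f : State → ℕ) {Q : List State} (hQ : Q.Nodup) (raw : Table)
    (h : ∀ r ∈ raw, bval r.2 ≠ 0 → r.1 ∈ Q) :
    (Q.map fun q => bval (totalAt raw q) * f q).sum = tval f raw := by
  induction raw with
  | nil => simp [totalAt, sumBits, bval, tval]
  | cons r raw ih =>
    have h1 : ∀ q, bval (totalAt (r :: raw) q) * f q =
        (if r.1 = q then bval r.2 * f q else 0) + bval (totalAt raw q) * f q := by
      intro q
      simp only [totalAt, bval_sumBits]
      by_cases hq : r.1 = q
      · simp [hq, add_mul]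
      · simp [hq]
    simp only [h1, List.sum_map_add, ih fun r hr => h r (by simp [hr])]
    have h2 : (Q.map fun q => if r.1 = q then bval r.2 * f q else 0).sum = bval r.2 * f r.1 := by
      rw [← List.sum_toFinset _ hQ, Finset.sum_ite_eq]
      split_ifs with hm
      · rfl
      · have : bval r.2 = 0 := by
          by_contra h0
          exact hm (List.mem_toFinset.2 (h r (by simp) h0))
        simp [this]
    simp [h2, tval]

theorem tval_flatMap (f : State → ℕ) (e : Ev) (tab : Table) :
    tval f (tab.flatMap fun r => (succStates e r.1).map fun q' => (q', r.2)) =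
      tval (fun q => ((succStates e q).map f).sum) tab := by
  induction tab with
  | nil => rfl
  | cons r tab ih =>
    simp only [tval, List.flatMap_cons, List.map_append, List.sum_append, List.map_cons,
      List.sum_cons, List.map_map] at ih ⊢
    rw [ih]
    congr 1
    exact List.sum_map_mul_left (r := bval r.2) ..

/-- The numbers in a state leave room for `n` more events. -/
def Roomy (k N n : ℕ) (q : State) : Prop :=
  q.1 ≤ N ∧ q.2.2.1 + n ≤ N ∧ q.2.2.2.length = k ∧ ∀ x ∈ q.2.2.2, x + n ≤ N

theorem Roomy.mem_states {k N n : ℕ} {q : State} (h : Roomy k N n q) : q ∈ states k N :=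
  SPControl.mem_states.2 ⟨h.1, by have := h.2.1; omega, h.2.2.1, fun x hx => by
    have := h.2.2.2 x hx; omega⟩

theorem Roomy.succ {k N n : ℕ} {q q' : State} {e : Ev} (h : Roomy k N (n + 1) q)
    (hq : q' ∈ succStates e q) : Roomy k N n q' := by
  obtain ⟨s, fl, t, w⟩ := q
  obtain ⟨h1, h2, h3, h4⟩ := h
  simp only at h1 h2 h3 h4
  rcases e with isP | opts
  · rcases w with _ | ⟨x, w⟩
    · simp [succStates, leave] at hq
    · have key : ∀ fl, Roomy k N n (s, fl, t, w ++ [0]) := by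
        refine fun fl => ⟨h1, by simp only; omega, by simpa using h3, fun y hy => ?_⟩
        simp only [List.mem_append, List.mem_singleton] at hy
        rcases hy with hy | rfl
        · have := h4 y (by simp [hy]); omega
        -- The new entry 0 has room because the counter of charged decisions has.
        · omega
      simp only [succStates, leave, Sum.elim_inl] at hq
      split_ifs at hq
      · rw [List.mem_singleton.1 hq]; exact key _
      · simp at hq
      · rw [List.mem_singleton.1 hq]; exact key _
  · obtain ⟨o, -, rfl⟩ := List.mem_map.1 hq
    refine ⟨h1, ?_, ?_, ?_⟩
    · simp only [decideVoter]; split_ifs <;> omega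
    · simp only [decideVoter]; split_ifs <;> simpa using h3
    · intro y hy
      simp only [decideVoter] at hy
      split_ifs at hy
      · obtain ⟨x, hx, rfl⟩ := List.mem_map.1 hy
        have := h4 x hx; omega
      · have := h4 y hy; omega

theorem exists_of_bval_sumBits_ne_zero {l : List (List Bool)} (h : bval (sumBits l) ≠ 0) :
    ∃ x ∈ l, bval x ≠ 0 := by
  by_contra! h0
  refine h ?_
  rw [bval_sumBits]
  exact List.sum_eq_zero fun y hy => by
    obtain ⟨x, hx, rfl⟩ := List.mem_map.1 hy
    exact h0 x hx

/-- Forward tables and the backward count are adjoint: moving one event from the count into the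
table does not change the weighted sum (`tval_flatMap`). Restricting to states with numbers up to
`N` loses nothing, since every row with nonzero value has room for the remaining events. -/
theorem tval_foldl_updateTable (target : Bool) (bound k N : ℕ) (evs : List Ev) :
    ∀ tab : Table, (∀ r ∈ tab, bval r.2 ≠ 0 → Roomy k N evs.length r.1) →
      tval (cnt target bound []) (evs.foldl (updateTable (states k N)) tab) =
        tval (cnt target bound evs) tab := by
  induction evs with
  | nil => intro tab _; rfl
  | cons e evs ih =>
    intro tab h
    have hraw : ∀ r ∈ tab.flatMap fun r => (succStates e r.1).map fun q' => (q', r.2),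
        bval r.2 ≠ 0 → Roomy k N evs.length r.1 := by
      intro r hr hne
      simp only [List.mem_flatMap, List.mem_map] at hr
      obtain ⟨r, hr, q', hq', rfl⟩ := hr
      exact (h r hr hne).succ hq'
    rw [List.foldl_cons, ih]
    · refine Eq.trans ?_ (tval_flatMap _ e tab)
      rw [← sum_totalAt _ (nodup_states k N) _ fun r hr hne => (hraw r hr hne).mem_states]
      simp [tval, updateTable, Function.comp_def]
    · intro r hr hne
      obtain ⟨q, -, rfl⟩ := List.mem_map.1 hr
      obtain ⟨x, hx, hx0⟩ := exists_of_bval_sumBits_ne_zero hne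
      obtain ⟨r, hr, rfl⟩ := List.mem_map.1 hx
      rw [List.mem_filter] at hr
      have := hraw r hr.1 hx0
      rwa [of_decide_eq_true hr.2] at this

theorem accepted_eq (target : Bool) (bound : ℕ) (tab : Table) :
    accepted target bound tab = encodeNat (tval (cnt target bound []) tab) := by
  rw [accepted, strip_eq, bval_sumBits]
  congr 1
  induction tab with
  | nil => rfl
  | cons r tab ih =>
    by_cases h : r.1.2.2.1 ≤ bound ∧ r.1.2.1 = target
    · simpa [tval, h, cnt] using ih
    · have h' : (decide (r.1.2.2.1 ≤ bound) && decide (r.1.2.1 = target)) = false := by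
        simpa using h
      rw [List.filter_cons_of_neg (by simp [h']), ih]
      simp [tval, cnt, h]

/-- Capping before a doubling does not affect the capped result, as a capped value stays at the cap
when doubled. -/
theorem capped_eq (bits : List Bool) (N : ℕ) : capped bits N = min (bval bits) N := by
  unfold capped
  rw [List.foldl_reverse]
  induction bits with
  | nil => simp [bval]
  | cons b l ih => rw [List.foldr_cons, ih]; cases b <;> simp [bval] <;> omega

theorem solve_eq (k : ℕ) (target : Bool) (axis : List (List Bool)) (voters : List Voter)
    (p bound : List Bool) (N : ℕ)
    (hN : (sweepEvents p axis voters).length + voters.length = N) :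
    solve k target axis voters p bound = encodeNat (((List.range (N + 1)).map fun s =>
      cnt target (min (bval bound) N) (sweepEvents p axis voters)
        (s, false, 0, List.replicate k 0)).sum) := by
  rw [solve, accepted_eq, hN, capped_eq, tval_foldl_updateTable]
  · simp [tval, initTable, bval, Function.comp_def]
  · intro r hr _
    obtain ⟨s, hs, rfl⟩ := List.mem_map.1 hr
    rw [List.mem_range] at hs
    refine ⟨by simp only; omega, by simp only; omega, by simp, fun x hx => ?_⟩
    rw [List.eq_of_mem_replicate hx]
    omega

/-! ## Correctness of the sweep -/

/-- The points that a voter with leftmost approved position `s` gives. -/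
def block (k s : ℕ) (x : ℕ) : ℕ := if s ≤ x ∧ x < s + k then 1 else 0

/-- The points that are given if the voter takes part. -/
def gain (k s : ℕ) (b : Bool) (f : ℕ → ℕ) (x : ℕ) : ℕ := if b = true then f x + block k s x else f x

/-- The sum of `Φ` over all decisions about the given voters, where `Φ` depends on the scores and
on the number of decisions that count against the bound. A voter is given by the leftmost
approved position and the possible decisions. -/
def choiceSum (k : ℕ) (Φ : (ℕ → ℕ) → ℕ → ℕ) : List (ℕ × Opts) → (ℕ → ℕ) → ℕ → ℕ
  | [], f, t => Φ f t
  | v :: l, f, t => (v.2.map fun o =>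
      choiceSum k Φ l (gain k v.1 o.2 f) (if o.1 = true then t + 1 else t)).sum

theorem gain_comm (k s s' : ℕ) (b b' : Bool) (f : ℕ → ℕ) :
    gain k s b (gain k s' b' f) = gain k s' b' (gain k s b f) := by
  funext x
  cases b <;> cases b' <;> simp [gain]
  omega

theorem sum_map_sum_map {α β : Type} (l : List α) (l' : List β) (f : α → β → ℕ) :
    (l.map fun x => (l'.map fun y => f x y).sum).sum =
      (l'.map fun y => (l.map fun x => f x y).sum).sum := by
  induction l with
  | nil => simp
  | cons x l ih => simp [ih, List.sum_map_add]

/-- Points and charged decisions add up independently of the order. This allows the sweep to treat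
the voters by leftmost position. -/
theorem choiceSum_perm {k : ℕ} {Φ : (ℕ → ℕ) → ℕ → ℕ} {l l' : List (ℕ × Opts)}
    (h : l.Perm l') : ∀ f t, choiceSum k Φ l f t = choiceSum k Φ l' f t := by
  induction h with
  | nil => intro f t; rfl
  | cons v _ ih => intro f t; simp only [choiceSum, ih]
  | swap v w l =>
    intro f t
    simp only [choiceSum]
    rw [sum_map_sum_map]
    refine congrArg List.sum (List.map_congr_left fun o _ => congrArg List.sum
      (List.map_congr_left fun o' _ => ?_))
    rw [gain_comm]
    congr 1
    split_ifs <;> rfl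
  | trans _ _ ih1 ih2 => intro f t; rw [ih1, ih2]

theorem choiceSum_append (k : ℕ) (Φ : (ℕ → ℕ) → ℕ → ℕ) (l l' : List (ℕ × Opts)) :
    ∀ f t, choiceSum k Φ (l ++ l') f t = choiceSum k (choiceSum k Φ l') l f t := by
  induction l with
  | nil => intro f t; rfl
  | cons v l ih => intro f t; simp only [choiceSum, List.cons_append, ih]

/-- Any property of the remaining voters and the scores that survives every decision may be assumed
when the final values are compared. -/
theorem choiceSum_congr {k : ℕ} {Φ Ψ : (ℕ → ℕ) → ℕ → ℕ}
    (inv : List (ℕ × Opts) → (ℕ → ℕ) → Prop)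
    (hinv : ∀ v l f b, inv (v :: l) f → inv l (gain k v.1 b f))
    (h : ∀ f t, inv [] f → Φ f t = Ψ f t) (l : List (ℕ × Opts)) :
    ∀ f t, inv l f → choiceSum k Φ l f t = choiceSum k Ψ l f t := by
  induction l with
  | nil => intro f t hf; exact h f t hf
  | cons v l ih =>
    intro f t hf
    exact congrArg List.sum (List.map_congr_left fun o _ => ih _ _ (hinv v l f o.2 hf))

theorem choiceSum_sum {α : Type} (k : ℕ) (Φ : α → (ℕ → ℕ) → ℕ → ℕ) (s : List α)
    (l : List (ℕ × Opts)) : ∀ f t, (s.map fun x => choiceSum k (Φ x) l f t).sum =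
      choiceSum k (fun f t => (s.map fun x => Φ x f t).sum) l f t := by
  induction l with
  | nil => intro f t; rfl
  | cons v l ih =>
    intro f t
    simp only [choiceSum]
    rw [sum_map_sum_map]
    simp only [ih]

theorem choiceSum_zero (k : ℕ) (l : List (ℕ × Opts)) :
    ∀ f t, choiceSum k (fun _ _ => 0) l f t = 0 := by
  induction l with
  | nil => intro f t; rfl
  | cons v l ih => intro f t; simp [choiceSum, ih]

/-- The events of the sweep, as a recursion along the axis. -/
def sweep (p : List Bool) : List (List Bool) → List Voter → List Ev
  | [], _ => []
  | a :: axis, vs => (vs.filter fun v => decide (a ∈ v.1)).map Prod.snd ++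
      Sum.inl (decide (a = p)) :: sweep p axis (vs.filter fun v => !decide (a ∈ v.1))

theorem sweepEvents_eq (p : List Bool) (axis : List (List Bool)) (vs : List Voter) :
    sweepEvents p axis vs = sweep p axis vs := by
  have : ∀ (axis : List (List Bool)) (vs : List Voter) (out : List Ev),
      (axis.foldl (sweepStep p) (vs, out)).2 = out ++ sweep p axis vs := by
    intro axis
    induction axis with
    | nil => simp [sweep]
    | cons a axis ih => intro vs out; rw [List.foldl_cons, sweepStep, ih]; simp [sweep]
  exact (this axis vs []).trans (by simp)

/-- The scores of the `k` candidates from position `j` on. -/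
def window (k : ℕ) (f : ℕ → ℕ) (j : ℕ) : List ℕ := (List.range k).map fun d => f (j + d)

/-- What the sweep computes from the final scores. -/
def sweepValue (target : Bool) (bound : ℕ) (p : List Bool) (s : ℕ) :
    Bool → ℕ → List (List Bool) → (ℕ → ℕ) → ℕ → ℕ
  | fl, _, [], _, t => if t ≤ bound ∧ fl = target then 1 else 0
  | fl, j, a :: axis, f, t =>
      if a = p then if f j = s then sweepValue target bound p s fl (j + 1) axis f t else 0
      else sweepValue target bound p s (fl || decide (s ≤ f j)) (j + 1) axis f t

/-- A voter starting at `j` approves exactly the positions of the window at `j`, so all remembered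
scores rise together. -/
theorem window_gain {k j : ℕ} (b : Bool) (f : ℕ → ℕ) :
    window k (gain k j b f) j =
      if b = true then (window k f j).map (· + 1) else window k f j := by
  cases b
  · simp [window, gain]
  · simp only [window, gain, if_true, List.map_map]
    refine List.map_congr_left fun d hd => ?_
    rw [List.mem_range] at hd
    simp [block, hd]

/-- The candidate entering on the right has no points yet. -/
theorem window_succ {k j : ℕ} {f : ℕ → ℕ} (hf : f (j + k + 1) = 0) :
    window (k + 1) f (j + 1) = (List.range k).map (fun d => f (j + 1 + d)) ++ [0] := by
  simp [window, List.range_succ, ← hf, add_right_comm]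

theorem cnt_append (target : Bool) (bound k s j : ℕ) (fl : Bool) (evs : List Ev)
    (l : List (ℕ × Opts)) : ∀ f t, (∀ v ∈ l, v.1 = j) →
      cnt target bound (l.map (fun v => Sum.inr v.2) ++ evs) (s, fl, t, window k f j) =
        choiceSum k (fun f t => cnt target bound evs (s, fl, t, window k f j)) l f t := by
  induction l with
  | nil => intro f t _; rfl
  | cons v l ih =>
    intro f t h
    simp only [List.map_cons, List.cons_append, cnt, choiceSum, succStates, Sum.elim_inr,
      List.map_map]
    refine congrArg List.sum (List.map_congr_left fun o _ => ?_)
    rw [← ih _ _ fun v hv => h v (by simp [hv]), h v (by simp), window_gain]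
    rfl

/-- A voter with the codes of the approved candidates, the leftmost approved position, and the
possible decisions. -/
abbrev PlacedVoter : Type := List (List Bool) × ℕ × Opts

/-- Induction along the axis. The voters starting at `j` are decided first; the later ones cannot
change the score at `j`, so the test made on leaving `j` agrees with the same test on the final
scores. -/
theorem cnt_sweep (target : Bool) (bound k s : ℕ) (hk : 0 < k) (p : List Bool)
    (axis : List (List Bool)) :
    ∀ (j : ℕ) (l : List PlacedVoter) (fl : Bool) (f : ℕ → ℕ) (t : ℕ),
      (∀ v ∈ l, j ≤ v.2.1 ∧ v.2.1 < j + axis.length) →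
      (∀ v ∈ l, ∀ d (h : d < axis.length), axis[d] ∈ v.1 ↔ v.2.1 ≤ j + d ∧ j + d < v.2.1 + k) →
      (∀ x, j + k ≤ x → f x = 0) →
      cnt target bound (sweep p axis (l.map fun v => (v.1, Sum.inr v.2.2)))
          (s, fl, t, window k f j) =
        choiceSum k (sweepValue target bound p s fl j axis) (l.map Prod.snd) f t := by
  induction axis with
  | nil =>
    intro j l fl f t h1 _ _
    cases l with
    | nil => rfl
    | cons v l => have := h1 v (by simp); simp at this; omega
  | cons a axis ih =>
    intro j l fl f t h1 h2 hf
    -- No remaining voter starts before `j`, and `0 < k` makes a voter approve the position where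
    -- the interval starts.
    have ha : ∀ v ∈ l, (a ∈ v.1 ↔ v.2.1 = j) := by
      intro v hv
      have h3 := h2 v hv 0 (by simp)
      have h4 := h1 v hv
      simp only [List.getElem_cons_zero] at h3
      rw [h3]; omega
    set l1 := l.filter fun v => decide (a ∈ v.1) with hl1
    set l2 := l.filter fun v => !decide (a ∈ v.1) with hl2
    have hm1 : ∀ v ∈ l1, v.2.1 = j := fun v hv => by
      rw [hl1, List.mem_filter] at hv
      exact (ha v hv.1).1 (of_decide_eq_true hv.2)
    have hm2 : ∀ v ∈ l2, v ∈ l ∧ j < v.2.1 := fun v hv => by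
      rw [hl2, List.mem_filter] at hv
      have h3 := h1 v hv.1
      have h4 := ha v hv.1
      have h5 : ¬ a ∈ v.1 := by simpa using hv.2
      have h6 : v.2.1 ≠ j := fun h => h5 (h4.2 h)
      exact ⟨hv.1, by omega⟩
    have hperm : (l.map Prod.snd).Perm (l1.map Prod.snd ++ l2.map Prod.snd) := by
      rw [← List.map_append]
      exact (List.filter_append_perm _ l).symm.map _
    have hsweep : sweep p (a :: axis) (l.map fun v => (v.1, Sum.inr v.2.2)) =
        (l1.map Prod.snd).map (fun v => Sum.inr v.2) ++ Sum.inl (decide (a = p)) ::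
          sweep p axis (l2.map fun v => (v.1, Sum.inr v.2.2)) := by
      simp [sweep, hl1, hl2, List.filter_map, Function.comp_def]
    rw [choiceSum_perm hperm, choiceSum_append, hsweep, cnt_append]
    swap
    · intro v hv
      obtain ⟨w, hw, rfl⟩ := List.mem_map.1 hv
      exact hm1 w hw
    -- Voters starting at `j` give no points from `j + k` on, so the zeros to the right of the
    -- window persist.
    refine choiceSum_congr (fun l f => (∀ v ∈ l, v.1 = j) ∧ ∀ x, j + k ≤ x → f x = 0)
      ?_ ?_ _ _ _ ⟨?_, hf⟩
    · rintro v l f b ⟨hl, hf⟩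
      refine ⟨fun v hv => hl v (by simp [hv]), fun x hx => ?_⟩
      have := hl v (by simp)
      simp only [gain, block, hf x hx]
      split_ifs <;> omega
    · rintro f t ⟨-, hf⟩
      have IH : ∀ fl, cnt target bound (sweep p axis (l2.map fun v => (v.1, Sum.inr v.2.2)))
          (s, fl, t, window k f (j + 1)) =
            choiceSum k (sweepValue target bound p s fl (j + 1) axis) (l2.map Prod.snd) f t := by
        intro fl
        refine ih (j + 1) l2 fl f t (fun v hv => ?_) (fun v hv d hd => ?_) fun x hx => ?_
        · have h3 := h1 v (hm2 v hv).1
          have h4 := (hm2 v hv).2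
          simp at h3; omega
        · have h3 := h2 v (hm2 v hv).1 (d + 1) (by simpa using hd)
          simp only [List.getElem_cons_succ] at h3
          rw [h3]; omega
        · exact hf x (by omega)
      -- All voters in `l2` start to the right of `j`; hence `f j` is already final and may replace
      -- the later score `g j`.
      have hval : choiceSum k (sweepValue target bound p s fl j (a :: axis))
          (l2.map Prod.snd) f t = choiceSum k (fun g t => if a = p then
            if f j = s then sweepValue target bound p s fl (j + 1) axis g t else 0
            else sweepValue target bound p s (fl || decide (s ≤ f j)) (j + 1) axis g t)
          (l2.map Prod.snd) f t := by
        refine choiceSum_congr (fun l g => (∀ v ∈ l, j < v.1) ∧ g j = f j) ?_ ?_ _ _ _ ⟨?_, rfl⟩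
        · rintro v l g b ⟨hl, hg⟩
          refine ⟨fun v hv => hl v (by simp [hv]), ?_⟩
          have := hl v (by simp)
          simp only [gain, block, hg]
          split_ifs <;> omega
        · rintro g t ⟨-, hg⟩
          simp only [sweepValue, hg]
        · intro v hv
          obtain ⟨w, hw, rfl⟩ := List.mem_map.1 hv
          exact (hm2 w hw).2
      rw [hval]
      obtain ⟨k, rfl⟩ : ∃ k', k = k' + 1 := ⟨k - 1, by omega⟩
      have hwin : window (k + 1) f j = f j :: (List.range k).map fun d => f (j + 1 + d) := by
        simp [window, List.range_succ_eq_map, Function.comp_def, add_assoc, add_comm 1]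
      rw [window_succ (hf _ (by omega))] at IH
      by_cases hp : a = p
      · by_cases hs : f j = s
        · simp [cnt, succStates, leave, hwin, hp, hs, ← IH]
        · simp [cnt, succStates, leave, hwin, hp, hs, choiceSum_zero]
      · simp [cnt, succStates, leave, hwin, hp, ← IH]
    · intro v hv
      obtain ⟨w, hw, rfl⟩ := List.mem_map.1 hv
      exact hm1 w hw

theorem sweepValue_eq (target : Bool) (bound : ℕ) (p : List Bool) (s : ℕ)
    (axis : List (List Bool)) (f : ℕ → ℕ) (t : ℕ) : ∀ (fl : Bool) (j : ℕ),
      sweepValue target bound p s fl j axis f t =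
        if (∀ d (h : d < axis.length), axis[d] = p → f (j + d) = s) ∧ t ≤ bound ∧
          ((fl = true ∨ ∃ d, ∃ h : d < axis.length, axis[d] ≠ p ∧ s ≤ f (j + d)) ↔ target = true)
        then 1 else 0 := by
  induction axis with
  | nil => intro fl j; cases fl <;> cases target <;> simp [sweepValue]
  | cons a axis ih =>
    intro fl j
    have hall : (∀ d (h : d < (a :: axis).length), (a :: axis)[d] = p → f (j + d) = s) ↔
        (a = p → f j = s) ∧ ∀ d (h : d < axis.length), axis[d] = p → f (j + 1 + d) = s := by
      constructor
      · intro h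
        refine ⟨h 0 (by simp), fun d hd => ?_⟩
        have := h (d + 1) (by simpa using hd)
        rwa [add_assoc, add_comm 1]
      · rintro ⟨h0, h⟩ (_ | d) hd
        · exact h0
        · have := h d (by simpa using hd)
          rwa [add_assoc, add_comm 1] at this
    have hex : (∃ d, ∃ h : d < (a :: axis).length, (a :: axis)[d] ≠ p ∧ s ≤ f (j + d)) ↔
        (a ≠ p ∧ s ≤ f j) ∨ ∃ d, ∃ h : d < axis.length, axis[d] ≠ p ∧ s ≤ f (j + 1 + d) := by
      constructor
      · rintro ⟨_ | d, hd, h⟩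
        · exact .inl h
        · refine .inr ⟨d, by simpa using hd, ?_⟩
          rwa [add_assoc, add_comm 1]
      · rintro (h | ⟨d, hd, h⟩)
        · exact ⟨0, by simp, h⟩
        · refine ⟨d + 1, by simpa using hd, ?_⟩
          rwa [add_assoc, add_comm 1] at h
    rw [sweepValue, ih, ih]
    by_cases hp : a = p
    · rw [if_pos hp]
      by_cases hs : f j = s
      · rw [if_pos hs]
        refine if_congr ?_ rfl rfl
        rw [hall, hex]
        simp [hp, hs]
      · rw [if_neg hs, eq_comm]
        refine if_neg ?_
        rw [hall]
        simp [hp, hs]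
    · rw [if_neg hp]
      refine if_congr ?_ rfl rfl
      rw [hall, hex]
      simp [hp, or_assoc]

/-! ## From choices to sets of voters -/

/-- Whether the choice is admissible: the designated candidate is at position `pos`. -/
def verdict (target : Bool) (bound m pos : ℕ) (f : ℕ → ℕ) (t : ℕ) : ℕ :=
  open Classical in
  if t ≤ bound ∧ ((∃ d < m, d ≠ pos ∧ f pos ≤ f d) ↔ target = true) then 1 else 0

/-- Only the guess `s = f pos` survives the test at the designated candidate, and the bound by `N`
ensures that this guess is among those tried. -/
theorem sum_sweepValue (target : Bool) (bound : ℕ) (p : List Bool) (axis : List (List Bool))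
    {pos N : ℕ} (hpos : pos < axis.length) (hp : ∀ d (h : d < axis.length), axis[d] = p ↔ d = pos)
    (f : ℕ → ℕ) (t : ℕ) (hf : f pos ≤ N) :
    ((List.range (N + 1)).map fun s => sweepValue target bound p s false 0 axis f t).sum =
      verdict target bound axis.length pos f t := by
  rw [← List.sum_toFinset _ List.nodup_range, Finset.sum_eq_single (f pos), sweepValue_eq, verdict]
  · refine if_congr ?_ rfl rfl
    have h1 : ∀ d (h : d < axis.length), axis[d] = p → f (0 + d) = f pos := fun d h hd => by
      rw [(hp d h).1 hd, zero_add]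
    have h2 : (∃ d, ∃ h : d < axis.length, axis[d] ≠ p ∧ f pos ≤ f (0 + d)) ↔
        ∃ d < axis.length, d ≠ pos ∧ f pos ≤ f d :=
      exists_congr fun d => ⟨fun ⟨h, h', h''⟩ => ⟨h, fun e => h' ((hp d h).2 e), by simpa using h''⟩,
        fun ⟨h, h', h''⟩ => ⟨h, fun e => h' ((hp d h).1 e), by simpa using h''⟩⟩
    rw [h2]
    simp only [Bool.false_eq_true, false_or]
    exact and_iff_right h1
  · intro s _ hs
    rw [sweepValue_eq]
    refine if_neg fun h => hs ?_
    have := h.1 pos hpos ((hp pos hpos).2 rfl)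
    rw [← this, zero_add]
  · intro h
    exact absurd (by simpa using Nat.lt_succ_of_le hf) h

/-- The exact `N` is irrelevant afterwards: it only has to be at least the number of voters, since
neither a score nor the number of charged decisions can exceed that. -/
theorem solve_eq_choiceSum {k : ℕ} (hk : 0 < k) (target : Bool) (axis : List (List Bool))
    (l : List PlacedVoter) (p bound : List Bool) {pos : ℕ} (hpos : pos < axis.length)
    (hp : ∀ d (h : d < axis.length), axis[d] = p ↔ d = pos)
    (h1 : ∀ v ∈ l, v.2.1 < axis.length)
    (h2 : ∀ v ∈ l, ∀ d (h : d < axis.length), axis[d] ∈ v.1 ↔ v.2.1 ≤ d ∧ d < v.2.1 + k) :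
    ∃ N, l.length ≤ N ∧
      solve k target axis (l.map fun v => (v.1, Sum.inr v.2.2)) p bound =
        encodeNat (choiceSum k (verdict target (min (bval bound) N) axis.length pos)
          (l.map Prod.snd) (fun _ => 0) 0) := by
  obtain ⟨N, hN⟩ : ∃ N, (sweepEvents p axis (l.map fun v => (v.1, Sum.inr v.2.2))).length +
    (l.map fun v => ((v.1, Sum.inr v.2.2) : Voter)).length = N := ⟨_, rfl⟩
  have hlN : l.length ≤ N := by rw [← hN]; simp
  refine ⟨N, hlN, (solve_eq k target axis _ p bound N hN).trans (congrArg encodeNat ?_)⟩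
  have hcnt : ∀ s, cnt target (min (bval bound) N)
      (sweepEvents p axis (l.map fun v => (v.1, Sum.inr v.2.2)))
      (s, false, 0, List.replicate k 0) =
      choiceSum k (sweepValue target (min (bval bound) N) p s false 0 axis) (l.map Prod.snd)
        (fun _ => 0) 0 := by
    intro s
    rw [sweepEvents_eq, ← cnt_sweep target _ k s hk p axis 0 l false (fun _ => 0) 0
      (fun v hv => by simpa using h1 v hv) (fun v hv d hd => by simpa using h2 v hv d hd)
      fun _ _ => rfl]
    simp [window]
  simp only [hcnt]
  rw [choiceSum_sum]
  refine choiceSum_congr (fun l f => f pos + l.length ≤ N) ?_ ?_ _ _ _ (by simpa using hlN)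
  · intro v l f b hf
    simp only [List.length_cons, gain, block] at hf ⊢
    split_ifs <;> omega
  · intro f t hf
    exact sum_sweepValue target _ p axis hpos hp f t (by simpa using hf)

/-- Registered voters in the adding problem have a single decision, which contributes fixed points
and no cost. -/
theorem choiceSum_forced (k : ℕ) (Φ : (ℕ → ℕ) → ℕ → ℕ) (l' : List (ℕ × Opts)) (t : ℕ) (l : List ℕ) :
    ∀ f, choiceSum k Φ (l.map (fun s => (s, [(false, true)])) ++ l') f t =
      choiceSum k Φ l' (fun x => f x + (l.map fun s => block k s x).sum) t := by
  induction l with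
  | nil => intro f; simp
  | cons s l ih =>
    intro f
    simp [choiceSum, ih, gain, add_assoc]

/-- The set `S` collects the voters whose costly decision is taken. The parameter `b` tells whether
the others take part: `false` models adding and `true` deleting. -/
theorem choiceSum_free {ι : Type} [DecidableEq ι] (k : ℕ) (Φ : (ℕ → ℕ) → ℕ → ℕ) (b : Bool)
    (start : ι → ℕ) (l : List ι) (hl : l.Nodup) : ∀ f t,
      choiceSum k Φ (l.map fun i => (start i, [(false, b), (true, !b)])) f t =
        ∑ S ∈ l.toFinset.powerset, Φ (fun x => f x + ∑ i ∈ l.toFinset,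
          if (i ∈ S ↔ b = false) then block k (start i) x else 0) (t + S.card) := by
  induction l with
  | nil => intro f t; simp [choiceSum]
  | cons i l ih =>
    intro f t
    have hi : i ∉ l.toFinset := by simpa using (List.nodup_cons.1 hl).1
    rw [List.toFinset_cons, Finset.sum_powerset_insert hi]
    simp only [List.map_cons, choiceSum, ih (List.nodup_cons.1 hl).2, List.map_nil, List.sum_cons,
      List.sum_nil, add_zero, Bool.false_eq_true, if_false, if_true]
    congr 1
    · refine Finset.sum_congr rfl fun S hS => ?_
      have hiS : i ∉ S := fun h => hi (Finset.mem_powerset.1 hS h)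
      congr 1
      funext x
      rw [Finset.sum_insert hi]
      cases b <;> simp [gain, hiS, add_assoc]
    · refine Finset.sum_congr rfl fun S hS => ?_
      have hiS : i ∉ S := fun h => hi (Finset.mem_powerset.1 hS h)
      rw [Finset.card_insert_of_notMem hiS]
      congr 1
      · funext x
        rw [Finset.sum_insert hi]
        have : ∀ j ∈ l.toFinset, (if (j ∈ insert i S ↔ b = false) then block k (start j) x else 0) =
            if (j ∈ S ↔ b = false) then block k (start j) x else 0 := fun j hj => by
          have : j ≠ i := fun h => hi (h ▸ hj)
          simp [this]
        rw [Finset.sum_congr rfl this]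
        cases b <;> simp [gain, add_assoc]
      · omega

/-! ## Single-peaked votes and approval -/

/-- The approved positions are convex: if a candidate between two approved ones were not approved,
it would be ranked below the left one, hence by single-peakedness above the right one, which is in
the top `k`. A convex set of `k` positions is an interval of length `k`. -/
theorem exists_start {m k : ℕ} (hm : 0 < m) (hk : 0 < k) {L v : Ranking m}
    (h : SinglePeaked L v) : ∃ s < m, ∀ c : Fin m,
      (v.symm c : ℕ) < k ↔ s ≤ L.symm c ∧ (L.symm c : ℕ) < s + k := by
  rcases le_or_gt m k with hmk | hmk
  -- With at most `k` candidates everybody is approved, and an interval starting at 0 may overhang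
  -- the axis.
  · exact ⟨0, hm, fun c => by have := (v.symm c).2; have := (L.symm c).2; omega⟩
  have conv : ∀ a b c : Fin m, a < b → b < c → (v.symm (L a) : ℕ) < k → (v.symm (L c) : ℕ) < k →
      (v.symm (L b) : ℕ) < k := by
    intro a b c hab hbc ha hc
    by_contra hb
    have h1 := h (L a) (L b) (L c) (.inl ⟨by simpa [Ranking.Before] using hab,
      by simpa [Ranking.Before] using hbc⟩) (Fin.lt_def.2 (by omega))
    have := Fin.lt_def.1 h1
    omega
  let A : Finset (Fin m) := Finset.univ.filter fun j => (v.symm (L j) : ℕ) < k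
  have hA : ∀ j, j ∈ A ↔ (v.symm (L j) : ℕ) < k := fun j => by simp [A]
  -- `A` is the image of the top `k` ranks under the bijection from ranks to axis positions.
  have hcard : A.card = k := by
    have : A = (Finset.univ.filter fun r : Fin m => (r : ℕ) < k).map
        (v.trans L.symm).toEmbedding := by
      ext j
      simp only [hA, Finset.mem_map, Finset.mem_filter, Finset.mem_univ, true_and]
      constructor
      · intro hj
        exact ⟨v.symm (L j), hj, by simp⟩
      · rintro ⟨r, hr, rfl⟩
        simpa using hr
    rw [this, Finset.card_map, Fin.card_filter_val_lt]
    omega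
  have hne : A.Nonempty := Finset.card_pos.1 (by omega)
  have hIcc : A = Finset.Icc (A.min' hne) (A.max' hne) := by
    ext j
    rw [Finset.mem_Icc]
    refine ⟨fun hj => ⟨A.min'_le j hj, A.le_max' j hj⟩, fun ⟨h1, h2⟩ => ?_⟩
    rcases h1.eq_or_lt with h1 | h1
    · exact h1 ▸ A.min'_mem hne
    rcases h2.eq_or_lt with h2 | h2
    · exact h2 ▸ A.max'_mem hne
    exact (hA j).2 (conv _ _ _ h1 h2 ((hA _).1 (A.min'_mem hne)) ((hA _).1 (A.max'_mem hne)))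
  have hlen : (A.max' hne : ℕ) + 1 - A.min' hne = k := by
    rw [← hcard]
    conv_rhs => rw [hIcc]
    simp
  refine ⟨A.min' hne, (A.min' hne).2, fun c => ?_⟩
  have h1 := hA (L.symm c)
  rw [hIcc, Finset.mem_Icc, Fin.le_def, Fin.le_def] at h1
  simp only [Equiv.apply_symm_apply] at h1
  rw [← h1]
  omega

/-- A candidate tied with a winner also wins, so uniqueness forces strict inequalities. -/
theorem isUniqueWinner_kApproval {k m : ℕ} {ι : Type} {vote : ι → Ranking m} {S : Finset ι}
    {p : Fin m} : (kApproval k).IsUniqueWinner vote S p ↔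
      ∀ d, d ≠ p → score k vote S d < score k vote S p := by
  simp only [VotingRule.IsUniqueWinner, kApproval, Set.ext_iff, Set.mem_ofPred_eq,
    Set.mem_singleton_iff]
  constructor
  · intro h d hd
    have hp := (h p).2 rfl
    refine lt_of_le_of_ne (hp d) fun e => hd ((h d).1 fun c => ?_)
    rw [e]; exact hp c
  · intro h c
    constructor
    · intro hc
      by_contra hcp
      exact absurd (hc p) (not_le.2 (h c hcp))
    · rintro rfl d
      by_cases hd : d = c
      · rw [hd]
      · exact (h d hd).le

/-! ### Candidates as binary codes, and correctness for the two control problems -/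

/-- The codes of the candidates in the order of a ranking. -/
def codes {m : ℕ} (v : Ranking m) : List (List Bool) :=
  List.ofFn fun r => encodeNat (v r)

theorem encodeNat_injective : Injective encodeNat :=
  LeftInverse.injective (g := Computability.decodeNat) Computability.decode_encodeNat

theorem encodeNat_mem_take_codes {m k : ℕ} {v : Ranking m} {c : Fin m} :
    encodeNat c ∈ (codes v).take k ↔ (v.symm c : ℕ) < k := by
  rw [List.mem_take_iff_getElem]
  simp only [codes, List.length_ofFn, List.getElem_ofFn, encodeNat_injective.eq_iff]
  constructor
  · rintro ⟨r, hr, h⟩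
    rw [Fin.val_inj] at h
    rw [← h]
    simp only [Equiv.symm_apply_apply]
    omega
  · intro h
    exact ⟨v.symm c, by have := (v.symm c).2; omega, by simp⟩

theorem score_eq {k m : ℕ} {ι : Type} {L : Ranking m} {vote : ι → Ranking m} {start : ι → ℕ}
    (h : ∀ i, ∀ c : Fin m, (((vote i).symm c : ℕ) < k ↔
      start i ≤ L.symm c ∧ (L.symm c : ℕ) < start i + k)) (S : Finset ι) (c : Fin m) :
    score k vote S c = ∑ i ∈ S, block k (start i) (L.symm c) := by
  rw [score, Finset.card_filter]
  exact Finset.sum_congr rfl fun i _ => if_congr (h i c) rfl rfl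

theorem not_isUniqueWinner_iff {k m : ℕ} {ι : Type} {vote : ι → Ranking m} {S : Finset ι}
    {L : Ranking m} {p : Fin m} {f : ℕ → ℕ} (hf : ∀ c, score k vote S c = f (L.symm c)) :
    (∃ d < m, d ≠ L.symm p ∧ f (L.symm p) ≤ f d) ↔
      ¬ (kApproval k).IsUniqueWinner vote S p := by
  rw [isUniqueWinner_kApproval]
  push Not
  constructor
  · rintro ⟨d, hd, hne, h⟩
    refine ⟨L ⟨d, hd⟩, ?_, ?_⟩
    · rintro rfl; simp at hne
    · rw [hf, hf]; simpa using h
  · rintro ⟨d, hd, h⟩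
    refine ⟨L.symm d, (L.symm d).2, ?_, by rwa [← hf, ← hf]⟩
    rw [Ne, Fin.val_inj]
    simpa using hd

/-- The voters of an instance of control by adding voters. -/
def votersAV (k : ℕ) (V W : List (List (List Bool))) : List Voter :=
  V.map (fun v => (v.take k, Sum.inr [(false, true)])) ++
    W.map fun v => (v.take k, Sum.inr [(false, false), (true, true)])

/-- The voters of an instance of control by deleting voters. -/
def votersDV (k : ℕ) (V : List (List (List Bool))) : List Voter :=
  V.map fun v => (v.take k, Sum.inr [(false, true), (true, false)])

theorem sum_ite_eq_ncard {α : Type} [Fintype α] (p : α → Prop) [DecidablePred p] :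
    (∑ x, if p x then 1 else 0) = {x | p x}.ncard := by
  rw [Finset.sum_boole, Set.ncard_eq_toFinset_card']
  simp

theorem codes_getElem_mem_iff {m k : ℕ} {L v : Ranking m} {s : ℕ}
    (h : ∀ c : Fin m, (v.symm c : ℕ) < k ↔ s ≤ L.symm c ∧ (L.symm c : ℕ) < s + k) (d : ℕ)
    (hd : d < (codes L).length) :
    (codes L)[d] ∈ (codes v).take k ↔ s ≤ d ∧ d < s + k := by
  have hd' : d < m := by simpa [codes] using hd
  have : (codes L)[d] = encodeNat (L ⟨d, hd'⟩) := by simp [codes]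
  rw [this, encodeNat_mem_take_codes, h]
  simp

theorem codes_getElem_eq_iff {m : ℕ} {L : Ranking m} {p : Fin m} (d : ℕ)
    (hd : d < (codes L).length) : (codes L)[d] = encodeNat p ↔ d = L.symm p := by
  have hd' : d < m := by simpa [codes] using hd
  have : (codes L)[d] = encodeNat (L ⟨d, hd'⟩) := by simp [codes]
  rw [this, encodeNat_injective.eq_iff, Fin.val_inj, ← Equiv.eq_symm_apply, Fin.ext_iff]

theorem solve_AV {k : ℕ} (hk : 0 < k) (target : Bool) (I : AVInstance) :
    solve k target (codes I.axis)
      (votersAV k (List.ofFn fun i => codes (I.V i)) (List.ofFn fun i => codes (I.W i)))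
      (encodeNat I.p) (encodeNat I.bound) =
    encodeNat {W' : Finset (Fin I.nW) |
      W'.card ≤ I.bound ∧ (¬ I.Wins (kApproval k) W' ↔ target = true)}.ncard := by
  classical
  have hm : 0 < I.m := I.p.pos
  choose sV hsV hV using fun i => exists_start hm hk (I.singlePeaked_V i)
  choose sW hsW hW using fun i => exists_start hm hk (I.singlePeaked_W i)
  let l : List PlacedVoter :=
    (List.ofFn fun i => ((codes (I.V i)).take k, sV i, [(false, true)])) ++
    (List.ofFn fun i => ((codes (I.W i)).take k, sW i, [(false, false), (true, true)]))
  have hv : votersAV k (List.ofFn fun i => codes (I.V i)) (List.ofFn fun i => codes (I.W i)) =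
      l.map fun v => (v.1, Sum.inr v.2.2) := by
    simp [votersAV, l, List.map_ofFn, Function.comp_def]
  have hl : l.map Prod.snd = (List.ofFn sV).map (fun s => (s, [(false, true)])) ++
      (List.finRange I.nW).map fun i => (sW i, [(false, false), (true, !false)]) := by
    simp [l, List.map_ofFn, Function.comp_def, ← List.ofFn_eq_map]
  have h1 : ∀ v ∈ l, v.2.1 < (codes I.axis).length := by
    intro v hv
    have : (codes I.axis).length = I.m := by simp [codes]
    rw [this]
    simp only [l, List.mem_append, List.mem_ofFn] at hv
    rcases hv with ⟨i, rfl⟩ | ⟨i, rfl⟩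
    exacts [hsV i, hsW i]
  have h2 : ∀ v ∈ l, ∀ d (h : d < (codes I.axis).length),
      (codes I.axis)[d] ∈ v.1 ↔ v.2.1 ≤ d ∧ d < v.2.1 + k := by
    intro v hv
    simp only [l, List.mem_append, List.mem_ofFn] at hv
    rcases hv with ⟨i, rfl⟩ | ⟨i, rfl⟩
    exacts [codes_getElem_mem_iff (hV i), codes_getElem_mem_iff (hW i)]
  obtain ⟨N, hN, hsolve⟩ := solve_eq_choiceSum hk target (codes I.axis) l (encodeNat I.p)
    (encodeNat I.bound) (pos := I.axis.symm I.p) (by simp [codes])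
    (fun d hd => codes_getElem_eq_iff d hd) h1 h2
  rw [hv, hsolve, hl, choiceSum_forced, choiceSum_free _ _ _ _ _ (List.nodup_finRange _)]
  congr 1
  rw [List.toFinset_finRange, Finset.powerset_univ, ← sum_ite_eq_ncard]
  refine Finset.sum_congr rfl fun S _ => ?_
  rw [verdict]
  refine if_congr (and_congr ?_ (iff_congr ?_ Iff.rfl)) rfl rfl
  -- Capping the bound at `N` is harmless, as no set of unregistered voters is larger than `N`.
  · have : S.card ≤ I.nW := by simpa using S.card_le_univ
    have h3 : I.nW ≤ N := by simp [l] at hN; omega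
    rw [bval_encodeNat]
    omega
  · have : (codes I.axis).length = I.m := by simp [codes]
    rw [this]
    refine not_isUniqueWinner_iff (vote := Sum.elim I.V I.W) (f := fun x =>
      0 + ((List.ofFn sV).map fun s => block k s x).sum +
        ∑ i, if (i ∈ S ↔ false = false) then block k (sW i) x else 0) fun c => ?_
    rw [score_eq (L := I.axis) (start := Sum.elim sV sW) (by rintro (i | i) <;> simp [hV, hW]),
      Finset.sum_disjSum]
    simp [List.map_ofFn, List.sum_ofFn, Finset.sum_ite_mem]

theorem solve_DV {k : ℕ} (hk : 0 < k) (target : Bool) (I : DVInstance) :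
    solve k target (codes I.axis) (votersDV k (List.ofFn fun i => codes (I.V i)))
      (encodeNat I.p) (encodeNat I.bound) =
    encodeNat {V' : Finset (Fin I.nV) |
      V'.card ≤ I.bound ∧ (¬ I.Wins (kApproval k) V' ↔ target = true)}.ncard := by
  classical
  have hm : 0 < I.m := I.p.pos
  choose sV hsV hV using fun i => exists_start hm hk (I.singlePeaked_V i)
  let l : List PlacedVoter :=
    List.ofFn fun i => ((codes (I.V i)).take k, sV i, [(false, true), (true, false)])
  have hv : votersDV k (List.ofFn fun i => codes (I.V i)) =
      l.map fun v => (v.1, Sum.inr v.2.2) := by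
    simp [votersDV, l, List.map_ofFn, Function.comp_def]
  have hl : l.map Prod.snd =
      (List.finRange I.nV).map fun i => (sV i, [(false, true), (true, !true)]) := by
    simp [l, List.map_ofFn, Function.comp_def, ← List.ofFn_eq_map]
  have h1 : ∀ v ∈ l, v.2.1 < (codes I.axis).length := by
    intro v hv
    have : (codes I.axis).length = I.m := by simp [codes]
    rw [this]
    simp only [l, List.mem_ofFn] at hv
    obtain ⟨i, rfl⟩ := hv
    exact hsV i
  have h2 : ∀ v ∈ l, ∀ d (h : d < (codes I.axis).length),
      (codes I.axis)[d] ∈ v.1 ↔ v.2.1 ≤ d ∧ d < v.2.1 + k := by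
    intro v hv
    simp only [l, List.mem_ofFn] at hv
    obtain ⟨i, rfl⟩ := hv
    exact codes_getElem_mem_iff (hV i)
  obtain ⟨N, hN, hsolve⟩ := solve_eq_choiceSum hk target (codes I.axis) l (encodeNat I.p)
    (encodeNat I.bound) (pos := I.axis.symm I.p) (by simp [codes])
    (fun d hd => codes_getElem_eq_iff d hd) h1 h2
  rw [hv, hsolve, hl, choiceSum_free _ _ _ _ _ (List.nodup_finRange _)]
  congr 1
  rw [List.toFinset_finRange, Finset.powerset_univ, ← sum_ite_eq_ncard]
  refine Finset.sum_congr rfl fun S _ => ?_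
  rw [verdict]
  refine if_congr (and_congr ?_ (iff_congr ?_ Iff.rfl)) rfl rfl
  · have : S.card ≤ I.nV := by simpa using S.card_le_univ
    have h3 : I.nV ≤ N := by simp [l] at hN; omega
    rw [bval_encodeNat]
    omega
  · have : (codes I.axis).length = I.m := by simp [codes]
    rw [this]
    -- Here `S` is the set of deleted voters; the condition `i ∈ S ↔ true = false` keeps exactly the
    -- others.
    refine not_isUniqueWinner_iff (vote := I.V) (f := fun x =>
      0 + ∑ i, if (i ∈ S ↔ true = false) then block k (sV i) x else 0) fun c => ?_
    rw [score_eq (L := I.axis) (start := sV) hV, ← Finset.sum_filter, zero_add]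
    congr 1
    ext i
    simp

/-! ## Reading the input and writing the output -/

/-- Parsing from right to left, on a stack of unfinished lists. -/
def parseStep : Γ' → T → T
  | .blank, t => t
  | .bit b, t => .cons (.cons (.cons (T.ofBool b) t.car.car) t.car.cdr) t.cdr
  | .bra, t => .cons (.cons t.car t.cdr.car) t.cdr.cdr
  | .ket, t => .cons .nil t
  | .comma, t => .cons (.cons .nil t.car) t.cdr

theorem pt_parseStep (x : Γ') : PT id (parseStep x) := by
  cases x with
  | blank => exact PT.refl _
  | bit b =>
    exact .cons (.cons (.cons (.const _) (.car (.car (.refl _)))) (.cdr (.car (.refl _))))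
      (.cdr (.refl _))
  | bra => exact .cons (.cons (.car (.refl _)) (.car (.cdr (.refl _)))) (.cdr (.cdr (.refl _)))
  | ket => exact .cons .nil (.refl _)
  | comma => exact .cons (.cons .nil (.car (.refl _))) (.cdr (.refl _))

/-- Equality holds for the empty tree, both of whose subtrees are again empty. -/
theorem size_car_cdr (t : T) : t.car.size + t.cdr.size ≤ t.size + 1 := by
  cases t <;> simp [T.car, T.cdr, T.size]; omega

theorem size_parseStep (x : Γ') (t : T) : (parseStep x t).size ≤ t.size + 10 := by
  have h1 := size_car_cdr t
  have h2 := size_car_cdr t.car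
  have h3 := size_car_cdr t.cdr
  cases x with
  | bit b => cases b <;> simp [parseStep, T.size, T.ofBool] <;> omega
  | _ => simp [parseStep, T.size] <;> omega

/-- The result of parsing a string. -/
def parse (s : List Γ') : T := s.foldr parseStep (.cons .nil .nil)

/-- Read from the right, the comma opens an empty string in the current list, and the bits are then
put in front in their original order. -/
theorem foldr_parseStep_encNat (n : ℕ) (t u : T) :
    (encNat n).foldr parseStep (.cons t u) = .cons (.cons (enc (encodeNat n)) t) u := by
  unfold encNat
  rw [List.foldr_append]
  induction encodeNat n with
  | nil => rfl
  | cons b l ih => rw [List.map_cons, List.foldr_cons, ih]; rfl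

/-- Read from the right, the closing bracket opens a new list on the stack, and the opening bracket
files it into the list below. -/
theorem foldr_parseStep_encList {α β : Type} [Enc β] {code : α → List Γ'} {e : α → β}
    (h : ∀ x t u, (code x).foldr parseStep (.cons t u) = .cons (.cons (enc (e x)) t) u)
    (l : List α) (t u : T) :
    (encList code l).foldr parseStep (.cons t u) = .cons (.cons (enc (l.map e)) t) u := by
  have : (l.flatMap code).foldr parseStep (.cons .nil (.cons t u)) =
      .cons (enc (l.map e)) (.cons t u) := by
    induction l with
    | nil => rfl
    | cons x l ih => rw [List.flatMap_cons, List.foldr_append, ih, h]; rfl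
  simp [encList, parseStep, this, T.car, T.cdr]

theorem foldr_parseStep_encRanking {m : ℕ} (v : Ranking m) (t u : T) :
    (encRanking v).foldr parseStep (.cons t u) = .cons (.cons (enc (codes v)) t) u := by
  rw [encRanking, foldr_parseStep_encList foldr_parseStep_encNat, List.map_ofFn]
  rfl

theorem foldr_parseStep_encVotes {m n : ℕ} (V : Fin n → Ranking m) (t u : T) :
    (encVotes V).foldr parseStep (.cons t u) =
      .cons (.cons (enc (List.ofFn fun i => codes (V i))) t) u := by
  rw [encVotes, foldr_parseStep_encList foldr_parseStep_encRanking, List.map_ofFn]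
  rfl

/-- Move the input to the second input stack. -/
def reverseInput : Cmd :=
  .loop .inp Option.isSome (
    .ite .inp (· == some .bra) (.push .rev .bra) (
    .ite .inp (· == some .ket) (.push .rev .ket) (
    .ite .inp (· == some .comma) (.push .rev .comma) (
    .ite .inp (· == some (.bit true)) (.push .rev (.bit true)) (
    .ite .inp (· == some (.bit false)) (.push .rev (.bit false)) (.push .rev .blank))))) ;;
    .pop .inp)

/-- Parsing starts at the last symbol, while the first one is on top of the input stack. -/
theorem runs_reverseInput (i r : List Γ') (m a b c : List Bool) :
    Runs reverseInput (st i r m a b c) (st [] (i.reverse ++ r) m a b c) (8 * i.length + 1) := by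
  unfold reverseInput
  induction i generalizing r with
  | nil => exact .loop_done rfl
  | cons x i ih =>
    refine Runs.mono (.loop_step (S' := st i (x :: r) m a b c) (n := 7) rfl
      (.seq (n := 6) (n' := 1) (S' := st (x :: i) (x :: r) m a b c) ?_ (.pop (by simp)))
      (by simpa using ih (x :: r))) (by simp; omega)
    rcases x with _ | (_ | _) | _ | _ | _
    · exact Runs.mono (.ite_false rfl (.ite_false rfl (.ite_false rfl (.ite_false rfl
        (.ite_false rfl (.push (by simp))))))) (by omega)
    · exact Runs.mono (.ite_false rfl (.ite_false rfl (.ite_false rfl (.ite_false rfl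
        (.ite_true rfl (.push (by simp))))))) (by omega)
    · exact Runs.mono (.ite_false rfl (.ite_false rfl (.ite_false rfl (.ite_true rfl
        (.push (by simp)))))) (by omega)
    · exact Runs.mono (.ite_true rfl (.push (by simp))) (by omega)
    · exact Runs.mono (.ite_false rfl (.ite_true rfl (.push (by simp)))) (by omega)
    · exact Runs.mono (.ite_false rfl (.ite_false rfl (.ite_true rfl (.push (by simp)))))
        (by omega)

/-- The input is parsed in polynomial time. -/
theorem exists_runs_parse : ∃ (c : Cmd) (P : Polynomial ℕ), ∀ s : List Γ',
    (parse s).size ≤ P.eval s.length ∧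
    Runs c (st s [] [] [] [] []) (st [] [] (parse s).code [] [] []) (P.eval s.length) := by
  choose cmd Q hQ using pt_parseStep
  -- A common time bound for the finitely many symbols.
  let R := ∑ x, Q x
  have hR : ∀ x n, (Q x).eval n ≤ R.eval n := fun x n => by
    rw [Polynomial.eval_finsetSum]
    exact Finset.single_le_sum (f := fun x => (Q x).eval n) (fun _ _ => Nat.zero_le _)
      (Finset.mem_univ x)
  let body : Cmd :=
    .ite .rev (· == some .bra) (cmd .bra) (
    .ite .rev (· == some .ket) (cmd .ket) (
    .ite .rev (· == some .comma) (cmd .comma) (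
    .ite .rev (· == some (.bit true)) (cmd (.bit true)) (
    .ite .rev (· == some (.bit false)) (cmd (.bit false)) (cmd .blank)))))
  have hbody : ∀ x r t, Runs body (st [] (x :: r) t.code [] [] [])
      (st [] (x :: r) (parseStep x t).code [] [] []) (5 + R.eval t.size) := by
    intro x r t
    have h1 := ((hQ x t).2 [] (x :: r) []).mono (hR x _)
    simp only [List.append_nil, _root_.id] at h1
    rcases x with _ | (_ | _) | _ | _ | _
    · exact Runs.mono (.ite_false rfl (.ite_false rfl (.ite_false rfl (.ite_false rfl
        (.ite_false rfl h1))))) (by omega)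
    · exact Runs.mono (.ite_false rfl (.ite_false rfl (.ite_false rfl (.ite_false rfl
        (.ite_true rfl h1))))) (by omega)
    · exact Runs.mono (.ite_false rfl (.ite_false rfl (.ite_false rfl (.ite_true rfl
        h1)))) (by omega)
    · exact Runs.mono (.ite_true rfl h1) (by omega)
    · exact Runs.mono (.ite_false rfl (.ite_true rfl h1)) (by omega)
    · exact Runs.mono (.ite_false rfl (.ite_false rfl (.ite_true rfl h1))) (by omega)
  -- A symbol enlarges the tree by at most 10, so `N` bounds all intermediate trees.
  have hloop : ∀ N (r : List Γ') (t : T), t.size + 10 * r.length ≤ N →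
      (r.foldl (fun t x => parseStep x t) t).size ≤ N ∧
      Runs (.loop .rev Option.isSome (body ;; .pop .rev)) (st [] r t.code [] [] [])
        (st [] [] (r.foldl (fun t x => parseStep x t) t).code [] [] [])
        (r.length * (7 + R.eval N) + 1) := by
    intro N r
    induction r with
    | nil => intro t ht; exact ⟨by simpa using ht, Runs.mono (.loop_done rfl) (by omega)⟩
    | cons x r ih =>
      intro t ht
      have h1 := size_parseStep x t
      have h2 := ih (parseStep x t) (by simp at ht; omega)
      refine ⟨h2.1, Runs.mono (.loop_step rfl ((hbody x r t).seq
        (.pop (S' := st [] r (parseStep x t).code [] [] []) (by simp))) h2.2) ?_⟩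
      have h3 := eval_mono R (show t.size ≤ N by omega)
      simp only [List.length_cons, Nat.succ_mul]
      omega
  refine ⟨reverseInput ;; .push .main false ;; .push .main false ;; .push .main true ;;
    .loop .rev Option.isSome (body ;; .pop .rev),
    8 * .X + 5 + (10 * .X + 3) + .X * (7 + R.comp (10 * .X + 3)), fun s => ?_⟩
  have h1 := runs_reverseInput s [] [] [] [] []
  have h2 := hloop (10 * s.length + 3) s.reverse (.cons .nil .nil) (by simp [T.size]; omega)
  rw [List.foldl_reverse, List.length_reverse] at h2
  simp only [List.append_nil] at h1
  refine ⟨h2.1.trans (by simp; omega), Runs.mono (h1.seq (.seq (.push rfl) (.seq (.push rfl)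
    (.seq (.push ?_) h2.2)))) ?_⟩
  · simp [T.code]
  · simp; omega

/-- Turn the tree of a list of bits into the list. -/
def writeOutput : Cmd :=
  .loop .main (· == some true) (.pop .main ;; .ite .main (· == some true)
    (.pop .main ;; .pop .main ;; .pop .main ;; .push .a true) (.pop .main ;; .push .a false)) ;;
  .pop .main ;; putA

/-- After a list constructor follows the tree of the bit, one symbol for `false` and three for
`true`, hence the different numbers of pops. The bits are collected in reverse and turned around by
`putA`. -/
theorem runs_writeOutput (l : List Bool) :
    Runs writeOutput (st [] [] (enc l).code [] [] []) (st [] [] l [] [] [])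
      (11 * l.length + 4) := by
  have key : ∀ (l a : List Bool), Runs (.loop .main (· == some true) (.pop .main ;;
      .ite .main (· == some true) (.pop .main ;; .pop .main ;; .pop .main ;; .push .a true)
        (.pop .main ;; .push .a false))) (st [] [] (enc l).code a [] [])
      (st [] [] [false] (l.reverse ++ a) [] []) (7 * l.length + 1) := by
    intro l
    induction l with
    | nil => intro a; exact .loop_done rfl
    | cons b l ih =>
      intro a
      refine Runs.mono (.loop_step (S' := st [] [] (enc l).code (b :: a) [] []) (n := 6) rfl ?_
        (by simpa using ih (b :: a))) (by simp; omega)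
      cases b
      · exact Runs.mono (.seq (.pop rfl) (.ite_false rfl (.seq (.pop rfl)
          (.push (by simp [enc, T.ofBool, T.code]))))) (by omega)
      · exact Runs.mono (.seq (.pop rfl) (.ite_true rfl (.seq (.pop rfl) (.seq (.pop rfl)
          (.seq (.pop rfl) (.push (by simp [enc, T.ofBool, T.code]))))))) (by omega)
  have h1 := key l []
  have h2 := runs_putA [] [] [] l.reverse [] []
  simp only [List.append_nil, List.reverse_reverse, List.length_reverse] at h1 h2
  exact Runs.mono (h1.seq (.seq (.pop (by simp)) h2)) (by omega)

/-- Parsing and writing are the same for all instances, so only the transformation of trees in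
between depends on the problem. -/
theorem inFP_of_pt {α : Type} {code : α → List Γ'} {f : α → ℕ}
    (h : PT (fun x => parse (code x)) (fun x => enc (encodeNat (f x)))) : InFP code f := by
  obtain ⟨c, P, hc⟩ := exists_runs_parse
  obtain ⟨d, Q, hd⟩ := h
  refine inFP_of_exec (c ;; d ;; writeOutput) (P + (12 * Q.comp P + 4)) fun x => ?_
  have h1 := hc (code x)
  have h2 := (hd x).2 [] [] []
  have h3 := runs_writeOutput (encodeNat (f x))
  simp only [List.append_nil] at h2
  have h4 := eval_mono Q h1.1
  have h5 := (hd x).1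
  have h6 := length_lt_sz (encodeNat (f x))
  simp only [sz] at h4 h5 h6
  refine (h1.2.seq (h2.seq h3)).mono ?_
  simp; omega

/-! ## Counting control problems for approval voting -/

/-- The parser closes the sequence of fields with an empty tree, which is the encoding of `()`; this
explains the last component of the input type. -/
theorem poly_solve_AV (k : ℕ) (target : Bool) :
    Poly (fun x : List (List Bool) × List (List (List Bool)) × List (List (List Bool)) ×
      List Bool × List Bool × Unit =>
        solve k target x.1 (votersAV k x.2.1 x.2.2.1) x.2.2.2.1 x.2.2.2.2.1) :=
  .solve k target (.fst .id)
    (.append (.map (.fst (.snd .id)) (.pair (.take k (.snd .id)) (.const _)))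
      (.map (.fst (.snd (.snd .id))) (.pair (.take k (.snd .id)) (.const _))))
    (.fst (.snd (.snd (.snd .id)))) (.fst (.snd (.snd (.snd (.snd .id)))))

theorem poly_solve_DV (k : ℕ) (target : Bool) :
    Poly (fun x : List (List Bool) × List (List (List Bool)) × List Bool × List Bool × Unit =>
        solve k target x.1 (votersDV k x.2.1) x.2.2.1 x.2.2.2.1) :=
  .solve k target (.fst .id)
    (.map (.fst (.snd .id)) (.pair (.take k (.snd .id)) (.const _)))
    (.fst (.snd (.snd .id))) (.fst (.snd (.snd (.snd .id))))

theorem inFP_AV {k : ℕ} (hk : 0 < k) (target : Bool) :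
    InFP AVInstance.encode fun I => {W' : Finset (Fin I.nW) |
      W'.card ≤ I.bound ∧ (¬ I.Wins (kApproval k) W' ↔ target = true)}.ncard := by
  have hp : ∀ I : AVInstance, parse I.encode = .cons (enc (codes I.axis,
      (List.ofFn fun i => codes (I.V i)), (List.ofFn fun i => codes (I.W i)),
      encodeNat I.p, encodeNat I.bound, ())) .nil := by
    intro I
    simp only [parse, AVInstance.encode, List.foldr_append, foldr_parseStep_encNat,
      foldr_parseStep_encVotes, foldr_parseStep_encRanking]
    rfl
  refine inFP_of_pt ?_
  simp only [hp, ← solve_AV hk]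
  exact PT.trans (PT.car (PT.refl _)) (PT.reindex (fun I : AVInstance => (codes I.axis,
      (List.ofFn fun i => codes (I.V i)), (List.ofFn fun i => codes (I.W i)),
      encodeNat I.p, encodeNat I.bound, ())) (poly_solve_AV k target))

theorem inFP_DV {k : ℕ} (hk : 0 < k) (target : Bool) :
    InFP DVInstance.encode fun I => {V' : Finset (Fin I.nV) |
      V'.card ≤ I.bound ∧ (¬ I.Wins (kApproval k) V' ↔ target = true)}.ncard := by
  have hp : ∀ I : DVInstance, parse I.encode = .cons (enc (codes I.axis,
      (List.ofFn fun i => codes (I.V i)), encodeNat I.p, encodeNat I.bound, ())) .nil := by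
    intro I
    simp only [parse, DVInstance.encode, List.foldr_append, foldr_parseStep_encNat,
      foldr_parseStep_encVotes, foldr_parseStep_encRanking]
    rfl
  refine inFP_of_pt ?_
  simp only [hp, ← solve_DV hk]
  exact PT.trans (PT.car (PT.refl _)) (PT.reindex (fun I : DVInstance => (codes I.axis,
      (List.ofFn fun i => codes (I.V i)), encodeNat I.p, encodeNat I.bound, ()))
      (poly_solve_DV k target))

end SPControl

theorem mainTheorem4 (k : ℕ) (hk : 0 < k) :
    SPControl.InFP SPControl.AVInstance.encode (SPControl.numCCAV (SPControl.kApproval k)) ∧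
    SPControl.InFP SPControl.DVInstance.encode (SPControl.numCCDV (SPControl.kApproval k)) ∧
    SPControl.InFP SPControl.AVInstance.encode (SPControl.numDCAV (SPControl.kApproval k)) ∧
    SPControl.InFP SPControl.DVInstance.encode (SPControl.numDCDV (SPControl.kApproval k)) := by
  refine ⟨?_, ?_, ?_, ?_⟩
  -- For `target = false` the condition on the verdict is a double negation of winning; for `true`
  -- it is the negation.
  · unfold SPControl.numCCAV; simpa using SPControl.inFP_AV hk false
  · unfold SPControl.numCCDV; simpa using SPControl.inFP_DV hk false
  · unfold SPControl.numDCAV; simpa using SPControl.inFP_AV hk true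
  · unfold SPControl.numDCDV; simpa using SPControl.inFP_DV hk true
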